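/- Let $N\ge 1$ be an integer and let $p,q$ be real numbers with $1<p<q$, and $q<1+\frac{4}{N-2}$ if $N\ge 3$. For $\omega\ge 0$ consider the equation $$-\Delta v+\omega v+|v|^{p-1}v-|v|^{q-1}v=0\quad\text{in }\mathbb{R}^N \qquad (\ast)$$ for complex-valued $v\in X_\omega$, where $X_\omega=H^1(\mathbb{R}^N)$ if $\omega>0$ and $X_0=\dot H^1(\mathbb{R}^N)\cap L^{p+1}(\mathbb{R}^N)$, and put $$S_\omega(v)=\tfrac12\|\nabla v\|_{L^2}^2+\tfrac{\omega}{2}\|v\|_{L^2}^2+\tfrac1{p+1}\|v\|_{L^{p+1}}^{p+1}-\tfrac1{q+1}\|v\|_{L^{q+1}}^{q+1}$$ (the second term being absent for $\omega=0$). A ground state for $\omega$ is a weak solution $v\in X_\omega\setminus\{0\}$ of $(\ast)$ that minimizes $S_\omega$ among all weak solutions of $(\ast)$ in $X_\omega\setminus\{0\}$. Let $\phi_\omega$ denote the positive, radial, radially decreasing ground state for $\omega$, and write $\phi_\omega(x)=\phi_\omega(r)$ with $r=|x|$. (i) Let $\rho=\max\{\frac{2}{p-1},N-2\}$. There are constants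 $C>0$ and $R>0$, depending only on $p,q,N$, such that $$\sup_{0\le\omega\le 1}\phi_\omega(r)\le C r^{-\rho}\qquad\text{for all } r\ge R.$$ (ii) If $N\ge 3$ and $p=\frac{N}{N-2}$, there are constants $C>0$ and $R>1$, depending only on $q,N$, such that $$\sup_{0\le\omega\le 1}\phi_\omega(r)\le C r^{-(N-2)}(\log r)^{-\frac{N-2}{2}}\qquad\text{for all } r\ge R.$$ -/

import Mathlib

noncomputable section

open MeasureTheory Set

namespace DoublePower

/-- The Euclidean space `ℝ^N`. -/
abbrev Space (N : ℕ) : Type := EuclideanSpace ℝ (Fin N)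

/-- Real-valued test functions: the elements of `C_c^∞(ℝ^N)`. -/
def IsTestFunction {N : ℕ} (ψ : Space N → ℝ) : Prop :=
  ContDiff ℝ ((⊤ : ℕ∞) : WithTop ℕ∞) ψ ∧ HasCompactSupport ψ

/-- The classical partial derivative `∂_i ψ`. -/
def partialDeriv {N : ℕ} (i : Fin N) (ψ : Space N → ℝ) (x : Space N) : ℝ :=
  fderiv ℝ ψ x (EuclideanSpace.single i 1)

/-- `G = (G_1, …, G_N)` is a weak (distributional) gradient of `v`:
`∫ v ∂_i ψ = - ∫ G_i ψ` for all test functions `ψ` and all `i`. -/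
def HasWeakGradient {N : ℕ} (v : Space N → ℂ) (G : Fin N → Space N → ℂ) : Prop :=
  LocallyIntegrable v ∧ (∀ i, LocallyIntegrable (G i)) ∧
    ∀ (i : Fin N) (ψ : Space N → ℝ), IsTestFunction ψ →
      ∫ x, v x * (partialDeriv i ψ x : ℂ) = - ∫ x, G i x * (ψ x : ℂ)

open Classical in
/-- The weak gradient `∇v`, which is unique almost everywhere (`0` by convention if there
is none). -/
def weakGradient {N : ℕ} (v : Space N → ℂ) : Fin N → Space N → ℂ :=
  if h : ∃ G, HasWeakGradient v G then h.choose else 0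

/-- The energy space `X_ω`: it is `H^1(ℝ^N)` for `ω > 0`, and
`Ḣ^1(ℝ^N) ∩ L^{p+1}(ℝ^N)` for `ω = 0`. -/
def MemEnergySpace {N : ℕ} (p ω : ℝ) (v : Space N → ℂ) : Prop :=
  HasWeakGradient v (weakGradient v) ∧ (∀ i, MemLp (weakGradient v i) 2) ∧
    (0 < ω → MemLp v 2) ∧ (ω = 0 → MemLp v (ENNReal.ofReal (p + 1)))

/-- The action
`S_ω(v) = ½‖∇v‖_2² + (ω/2)‖v‖_2² + ‖v‖_{p+1}^{p+1}/(p+1) - ‖v‖_{q+1}^{q+1}/(q+1)`.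
For `ω = 0` the second term vanishes, whether or not `v` is in `L²`. -/
def action {N : ℕ} (p q ω : ℝ) (v : Space N → ℂ) : ℝ :=
  1 / 2 * (∑ i, ∫ x, ‖weakGradient v i x‖ ^ 2) + ω / 2 * (∫ x, ‖v x‖ ^ 2)
    + 1 / (p + 1) * (∫ x, ‖v x‖ ^ (p + 1)) - 1 / (q + 1) * (∫ x, ‖v x‖ ^ (q + 1))

/-- `S_ω'(v) = 0`, that is, `v` solves
`-Δv + ωv + |v|^{p-1}v - |v|^{q-1}v = 0` in the weak sense. -/
def IsWeakSolution {N : ℕ} (p q ω : ℝ) (v : Space N → ℂ) : Prop :=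
  ∀ ψ : Space N → ℝ, IsTestFunction ψ →
    ∫ x, ((∑ i, weakGradient v i x * (partialDeriv i ψ x : ℂ))
      + ((ω : ℂ) * v x + ((‖v x‖ ^ (p - 1) : ℝ) : ℂ) * v x
          - ((‖v x‖ ^ (q - 1) : ℝ) : ℂ) * v x) * (ψ x : ℂ)) = 0

/-- The set `𝒜_ω` of nontrivial solutions in the energy space. -/
def solutionSet (N : ℕ) (p q ω : ℝ) : Set (Space N → ℂ) :=
  {v | MemEnergySpace p ω v ∧ ¬ (v =ᵐ[volume] 0) ∧ IsWeakSolution p q ω v}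

/-- The level `d(ω) = inf {S_ω(v) : v ∈ 𝒜_ω}`, as an extended real number. -/
def groundLevel (N : ℕ) (p q ω : ℝ) : EReal :=
  ⨅ v ∈ solutionSet N p q ω, (action p q ω v : EReal)

/-- The set `𝒢_ω` of ground states. -/
def groundStates (N : ℕ) (p q ω : ℝ) : Set (Space N → ℂ) :=
  {v | v ∈ solutionSet N p q ω ∧ (action p q ω v : EReal) = groundLevel N p q ω}

/-- `φ` is the radial profile of a positive, radial, decreasing ground state
`x ↦ φ(|x|)`. -/
def IsGroundStateProfile (N : ℕ) (p q ω : ℝ) (φ : ℝ → ℝ) : Prop :=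
  (∀ r, 0 ≤ r → 0 < φ r) ∧ AntitoneOn φ (Ici 0) ∧
    (fun x : Space N => (φ ‖x‖ : ℂ)) ∈ groundStates N p q ω

end DoublePower

end

/-! With n = N - 1, the profile solves (r^n φ')' = r^n (ωφ + φ^p - φ^q). The bounds follow from this
ODE together with positivity, monotonicity and φ → 0. Testing the weak equation with radial
functions makes the ODE classical (`exists_hasDerivAt_of_weak`), as a first order system for φ and
the flux w = -r^n φ'.

Rate 2/(p-1): the energy φ'²/2 - V(φ), with V(s) = ωs²/2 + s^(p+1)/(p+1) - s^(q+1)/(q+1), decreases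
in r and is nonnegative because V(φ) → 0 (`energy_nonneg`). Beyond a radius free of ω, φ^q cannot
dominate φ^p + ωφ (`not_dominated`): domination at r would persist on (0, r], where the flux forces
-φ' ≥ k φ^q from radius 1 on, and that bounds r. Hence V(φ) ≥ c φ^(p+1), so -φ' ≥ √(2c) φ^((p+1)/2),
which integrates to the rate (`exists_decay_rpow`).

Rate N - 2: the decay just found makes the nonlinearity at least φ^p/2 far out, so w decreases
there. It is bounded uniformly, and comparison with a multiple of r^(-(N-2)) bounds φ by w
(`exists_flux_bound`).

Logarithm: put k = N - 2 and u = r^k φ. If p = (k+2)/k, then w' ≤ -u^p/(2r) and u' = (ku - w)/r,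
whence y = w + u satisfies y' ≤ -κ y^p/r. Integrating in log r gives the factor (log r)^(-k/2)
(`exists_decay_log`). -/

namespace DoublePower

open MeasureTheory Set Filter Topology

/-! ### Test functions on the half line -/

/-- Smooth functions on the line with compact support inside `(0, ∞)`. -/
structure IsPosTest (η : ℝ → ℝ) : Prop where
  contDiff : ContDiff ℝ ((⊤ : ℕ∞) : WithTop ℕ∞) η
  support : ∃ a b, 0 < a ∧ a < b ∧ ∀ x, x ∉ Icc a b → η x = 0

namespace IsPosTest

variable {η ζ : ℝ → ℝ}

lemma of_tsupport (h : ContDiff ℝ ((⊤ : ℕ∞) : WithTop ℕ∞) η) (hc : HasCompactSupport η)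
    (hs : tsupport η ⊆ Ioi 0) : IsPosTest η := by
  refine ⟨h, ?_⟩
  rcases (tsupport η).eq_empty_or_nonempty with he | hne
  · refine ⟨1, 2, one_pos, one_lt_two, fun x _ => image_eq_zero_of_notMem_tsupport ?_⟩
    simp [he]
  · have hK : IsCompact (tsupport η) := hc
    obtain ⟨a, ha⟩ := hK.exists_isLeast hne
    obtain ⟨b, hb⟩ := hK.exists_isGreatest hne
    refine ⟨a, b + 1, hs ha.1, by linarith [ha.2 hb.1], fun x hx =>
      image_eq_zero_of_notMem_tsupport fun hx' => hx ⟨ha.2 hx', ?_⟩⟩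
    linarith [hb.2 hx']

lemma hasCompactSupport (h : IsPosTest η) : HasCompactSupport η := by
  obtain ⟨a, b, -, -, h0⟩ := h.support
  exact HasCompactSupport.intro isCompact_Icc h0

lemma continuous (h : IsPosTest η) : Continuous η := h.contDiff.continuous

lemma differentiable (h : IsPosTest η) : Differentiable ℝ η :=
  h.contDiff.differentiable (by simp)

lemma eq_zero_of_nonpos (h : IsPosTest η) {x : ℝ} (hx : x ≤ 0) : η x = 0 := by
  obtain ⟨a, b, ha, -, h0⟩ := h.support
  exact h0 x fun h => by linarith [h.1]

lemma eventually_eq_zero (h : IsPosTest η) {x : ℝ} (hx : x ≤ 0) : η =ᶠ[𝓝 x] 0 := by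
  obtain ⟨a, b, ha, -, h0⟩ := h.support
  filter_upwards [Iio_mem_nhds (hx.trans_lt ha)] with y hy
  exact h0 y fun h => absurd h.1 (not_le.2 hy)

lemma sub (h : IsPosTest η) (k : IsPosTest ζ) : IsPosTest (fun x => η x - ζ x) := by
  obtain ⟨a, b, ha, hab, h0⟩ := h.support
  obtain ⟨a', b', ha', hab', k0⟩ := k.support
  refine ⟨h.contDiff.sub k.contDiff, min a a', max b b', lt_min ha ha',
    (min_le_left _ _).trans_lt (hab.trans_le (le_max_left _ _)), fun x hx => ?_⟩
  rw [h0 x fun hx' => hx ⟨(min_le_left _ _).trans hx'.1, hx'.2.trans (le_max_left _ _)⟩,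
    k0 x fun hx' => hx ⟨(min_le_right _ _).trans hx'.1, hx'.2.trans (le_max_right _ _)⟩, sub_zero]

/-- The product with a function that is smooth on `(0, ∞)`. -/
lemma mul {f : ℝ → ℝ} (h : IsPosTest η)
    (hf : ContDiffOn ℝ ((⊤ : ℕ∞) : WithTop ℕ∞) f (Ioi 0)) : IsPosTest (fun x => η x * f x) := by
  obtain ⟨a, b, ha, hab, h0⟩ := h.support
  refine ⟨contDiff_iff_contDiffAt.2 fun x => ?_, a, b, ha, hab, fun x hx => by simp [h0 x hx]⟩
  rcases le_or_gt x 0 with hx | hx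
  · refine (contDiffAt_const (c := (0 : ℝ))).congr_of_eventuallyEq ?_
    filter_upwards [h.eventually_eq_zero hx] with y hy
    simp [hy]
  · exact h.contDiff.contDiffAt.mul (hf.contDiffAt (Ioi_mem_nhds hx))

lemma const_mul (h : IsPosTest η) (c : ℝ) : IsPosTest (fun x => c * η x) := by
  simpa only [mul_comm] using h.mul (contDiffOn_const (c := c))

lemma isPosTest_deriv (h : IsPosTest η) : IsPosTest (deriv η) := by
  obtain ⟨a, b, ha, hab, h0⟩ := h.support
  refine ⟨(contDiff_infty_iff_deriv.1 h.contDiff).2, a, b, ha, hab, fun x hx => ?_⟩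
  have : η =ᶠ[𝓝 x] fun _ => 0 := by
    filter_upwards [isClosed_Icc.isOpen_compl.mem_nhds hx] with y hy using h0 y hy
  rw [this.deriv_eq]; simp

lemma integrable (h : IsPosTest η) : Integrable η :=
  h.continuous.integrable_of_hasCompactSupport h.hasCompactSupport

lemma integrable_mul {D : ℝ → ℝ} (h : IsPosTest η) (hD : LocallyIntegrableOn D (Ioi 0)) :
    Integrable (fun x => D x * η x) := by
  obtain ⟨a, b, ha, hab, h0⟩ := h.support
  have hI : IntegrableOn D (Icc a b) :=
    hD.integrableOn_compact_subset (fun x hx => lt_of_lt_of_le ha hx.1) isCompact_Icc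
  refine (integrableOn_iff_integrable_of_support_subset (s := Icc a b) ?_).1
    (hI.mul_continuousOn h.continuous.continuousOn isCompact_Icc)
  intro x hx
  by_contra hx'
  exact hx (by simp [h0 x hx'])

/-- Integrals against a test function live on a compact interval. -/
lemma integral_eq_interval {a b : ℝ} (hab : a ≤ b) {f : ℝ → ℝ} (h0 : ∀ x, x ∉ Icc a b → f x = 0) :
    ∫ x, f x = ∫ x in a..b, f x := by
  rw [intervalIntegral.integral_of_le hab, ← integral_Icc_eq_integral_Ioc,
    setIntegral_eq_integral_of_forall_compl_eq_zero h0]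

/-- A test function with zero mean is the derivative of a test function. -/
lemma exists_primitive (h : IsPosTest ζ) (h0 : ∫ x, ζ x = 0) :
    ∃ Z, IsPosTest Z ∧ ∀ x, HasDerivAt Z (ζ x) x := by
  obtain ⟨a, b, ha, hab, hz⟩ := h.support
  have hd : ∀ x, HasDerivAt (fun x => ∫ t in a..x, ζ t) (ζ x) x := fun x =>
    (h.continuous.integral_hasStrictDerivAt a x).hasDerivAt
  refine ⟨fun x => ∫ t in a..x, ζ t, ⟨?_, a, b, ha, hab, fun x hx => ?_⟩, hd⟩
  · refine contDiff_infty_iff_deriv.2 ⟨fun x => (hd x).differentiableAt, ?_⟩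
    rw [funext fun x => (hd x).deriv]
    exact h.contDiff
  · have zero : ∀ c d : ℝ, (∀ t ∈ uIcc c d, ζ t = 0) → ∫ t in c..d, ζ t = 0 := fun c d hcd => by
      rw [intervalIntegral.integral_congr (g := fun _ => (0 : ℝ)) hcd]; simp
    -- The support condition says nothing at the endpoints themselves; continuity supplies the zeros
    -- there.
    have hza : ζ a = 0 := by
      have : Tendsto ζ (𝓝[<] a) (𝓝 (ζ a)) := h.continuous.continuousWithinAt
      refine tendsto_nhds_unique this (tendsto_const_nhds.congr' ?_)
      filter_upwards [self_mem_nhdsWithin] with y hy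
      exact (hz y fun h => absurd h.1 (not_le.2 hy)).symm
    have hzb : ζ b = 0 := by
      have : Tendsto ζ (𝓝[>] b) (𝓝 (ζ b)) := h.continuous.continuousWithinAt
      refine tendsto_nhds_unique this (tendsto_const_nhds.congr' ?_)
      filter_upwards [self_mem_nhdsWithin] with y hy
      exact (hz y fun h => absurd h.2 (not_le.2 hy)).symm
    rcases lt_or_ge x a with hxa | hxa
    · refine zero a x fun t ht => ?_
      rw [uIcc_of_ge hxa.le] at ht
      rcases ht.2.lt_or_eq with h1 | h1
      · exact hz t fun h => absurd h.1 (not_le.2 h1)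
      · rw [h1, hza]
    · have hxb : b < x := by
        by_contra hxb
        exact hx ⟨hxa, not_lt.1 hxb⟩
      have hi : ∀ c d : ℝ, IntervalIntegrable ζ volume c d := fun c d =>
        h.continuous.intervalIntegrable c d
      change ∫ t in a..x, ζ t = 0
      rw [← intervalIntegral.integral_add_adjacent_intervals (hi a b) (hi b x),
        ← integral_eq_interval hab.le hz, h0, zero b x, zero_add]
      intro t ht
      rw [uIcc_of_le hxb.le] at ht
      rcases ht.1.lt_or_eq with h1 | h1
      · exact hz t fun h => absurd h.2 (not_le.2 h1)
      · rw [← h1, hzb]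

/-- There is a test function with unit mean. -/
lemma exists_integral_eq_one : ∃ ζ, IsPosTest ζ ∧ ∫ x, ζ x = 1 := by
  let f : ContDiffBump (2 : ℝ) := ⟨1 / 2, 1, by norm_num, by norm_num⟩
  refine ⟨f.normed volume, ⟨f.contDiff_normed, 1, 3, one_pos, by norm_num, fun x hx => ?_⟩,
    f.integral_normed⟩
  have : x ∉ Function.support (f.normed volume) := by
    rw [f.support_normed_eq, Real.ball_eq_Ioo]
    intro h
    exact hx ⟨by have := h.1; norm_num [f] at this; linarith,
      by have := h.2; norm_num [f] at this; linarith⟩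
  simpa using this

end IsPosTest

/-! ### One-dimensional regularity: from weak to classical solutions -/

/-- The du Bois-Reymond lemma on `(0, ∞)`. -/
lemma ae_eq_const_of_integral_mul_deriv_eq_zero {D : ℝ → ℝ} (hD : LocallyIntegrableOn D (Ioi 0))
    (h : ∀ Z, IsPosTest Z → ∫ x, D x * deriv Z x = 0) :
    ∃ c, ∀ᵐ x, x ∈ Ioi (0 : ℝ) → D x = c := by
  obtain ⟨ζ₀, hζ₀, hone⟩ := IsPosTest.exists_integral_eq_one
  set c := ∫ x, D x * ζ₀ x with hc
  refine ⟨c, ?_⟩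
  have key : ∀ᵐ x, x ∈ Ioi (0 : ℝ) → D x - c = 0 := by
    have hcL : LocallyIntegrableOn (fun _ : ℝ => c) (Ioi 0) :=
      (locallyIntegrable_const c).locallyIntegrableOn _
    refine isOpen_Ioi.ae_eq_zero_of_integral_contDiff_smul_eq_zero (hD.sub hcL) ?_
    intro ζ hζ hζc hζs
    have ht : IsPosTest ζ := .of_tsupport hζ hζc hζs
    set m := ∫ x, ζ x with hm
    -- Subtracting m ζ₀ removes the mean, so the difference is a derivative to which the hypothesis
    -- applies.
    have hsub : IsPosTest (fun x => ζ x - m * ζ₀ x) := ht.sub (hζ₀.const_mul m)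
    obtain ⟨Z, hZ, hZd⟩ := hsub.exists_primitive (by
      rw [integral_sub ht.integrable (hζ₀.const_mul m).integrable, integral_const_mul, hone]
      simp [hm])
    have h1 := h Z hZ
    rw [funext fun x => (hZd x).deriv] at h1
    have h2 : ∫ x, D x * (ζ x - m * ζ₀ x) = (∫ x, D x * ζ x) - m * c := by
      rw [hc, ← integral_const_mul, ← integral_sub (ht.integrable_mul hD)
        ((hζ₀.integrable_mul hD).const_mul m)]
      congr 1; ext x; ring
    have h3 : ∫ x, ζ x • (D x - c) = (∫ x, D x * ζ x) - c * m := by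
      rw [hm, ← integral_const_mul, ← integral_sub (ht.integrable_mul hD)
        (ht.integrable.const_mul c)]
      congr 1; ext x; rw [smul_eq_mul]; ring
    rw [h3, mul_comm c m, ← h2, h1]
  filter_upwards [key] with x hx hx0
  linarith [hx hx0]

/-- Integration by parts against a primitive. -/
lemma integral_mul_eq_neg_integral_primitive_mul_deriv {h η : ℝ → ℝ}
    (hh : LocallyIntegrableOn h (Ioi 0)) (hη : IsPosTest η) :
    ∫ x, h x * η x = -∫ x, (∫ t in (1 : ℝ)..x, h t) * deriv η x := by
  obtain ⟨a, b, ha, hab, h0⟩ := hη.support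
  have hbig : ∀ x, x ∉ Icc (min (a / 2) 1) (max (b + 1) 1) → x ∉ Icc a b := fun x hx hx' =>
    hx ⟨by linarith [min_le_left (a / 2) 1, hx'.1], by linarith [le_max_left (b + 1) 1, hx'.2]⟩
  -- The window [A, B] contains the support of η, with room at both ends, and also the base point 1
  -- of the primitive.
  set A := min (a / 2) 1 with hA
  set B := max (b + 1) 1 with hB
  have hA0 : 0 < A := lt_min (by linarith) one_pos
  have hAB : A ≤ B := (min_le_right _ _).trans (le_max_right _ _)
  have hI : IntervalIntegrable h volume A B := by
    rw [intervalIntegrable_iff_integrableOn_Icc_of_le hAB]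
    exact hh.integrableOn_compact_subset (fun x hx => lt_of_lt_of_le hA0 hx.1) isCompact_Icc
  have hF := hI.absolutelyContinuousOnInterval_intervalIntegral (c := 1)
    (by rw [uIcc_of_le hAB]; exact ⟨min_le_right _ _, le_max_right _ _⟩)
  have hE : AbsolutelyContinuousOnInterval η A B :=
    (hη.contDiff.of_le (by simp)).contDiffOn.absolutelyContinuousOnInterval
  have hp := hF.integral_mul_deriv_eq_deriv_mul hE
  have hηA : η A = 0 := h0 A fun h => by linarith [h.1, min_le_left (a / 2) 1]
  have hηB : η B = 0 := h0 B fun h => by linarith [h.2, le_max_left (b + 1) 1]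
  have hd0 : ∀ x, x ∉ Icc a b → deriv η x = 0 := fun x hx => by
    have : η =ᶠ[𝓝 x] fun _ => 0 := by
      filter_upwards [isClosed_Icc.isOpen_compl.mem_nhds hx] with y hy using h0 y hy
    rw [this.deriv_eq]; simp
  rw [IsPosTest.integral_eq_interval hAB (fun x hx => by rw [h0 x (hbig x hx), mul_zero]),
    IsPosTest.integral_eq_interval hAB (fun x hx => by rw [hd0 x (hbig x hx), mul_zero]), hp,
    hηA, hηB]
  have : ∫ x in A..B, deriv (fun x => ∫ t in (1 : ℝ)..x, h t) x * η x = ∫ x in A..B, h x * η x := by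
    refine intervalIntegral.integral_congr_ae ?_
    filter_upwards [hI.ae_hasDerivAt_integral] with x hx hx'
    rw [(hx (uIoc_subset_uIcc hx') 1 (by
      rw [uIcc_of_le hAB]; exact ⟨min_le_right _ _, le_max_right _ _⟩)).deriv]
  rw [this]; ring

lemma continuousOn_primitive {h : ℝ → ℝ} (hh : LocallyIntegrableOn h (Ioi 0)) :
    ContinuousOn (fun x => ∫ t in (1 : ℝ)..x, h t) (Ioi 0) := by
  intro x (hx : 0 < x)
  have hA0 : 0 < min (x / 2) 1 := lt_min (by linarith) one_pos
  have hAB : min (x / 2) 1 ≤ max (x + 1) 1 := (min_le_right _ _).trans (le_max_right _ _)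
  have hI : IntervalIntegrable h volume (min (x / 2) 1) (max (x + 1) 1) := by
    rw [intervalIntegrable_iff_integrableOn_Icc_of_le hAB]
    exact hh.integrableOn_compact_subset (fun x hx => lt_of_lt_of_le hA0 hx.1) isCompact_Icc
  have hF := (hI.absolutelyContinuousOnInterval_intervalIntegral (c := 1)
    (by rw [uIcc_of_le hAB]; exact ⟨min_le_right _ _, le_max_right _ _⟩)).continuousOn
  rw [uIcc_of_le hAB] at hF
  exact (hF.continuousAt (Icc_mem_nhds (by linarith [min_le_left (x / 2) 1])
    (by linarith [le_max_left (x + 1) 1]))).continuousWithinAt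

/-- On `(0, ∞)`, a continuous function agreeing almost everywhere with an antitone function agrees
with it everywhere. -/
lemma eqOn_of_ae_eq_of_antitoneOn {φ K : ℝ → ℝ} (hφ : AntitoneOn φ (Ioi 0))
    (hK : ContinuousOn K (Ioi 0)) (h : ∀ᵐ x, x ∈ Ioi (0 : ℝ) → φ x = K x) :
    EqOn φ K (Ioi 0) := by
  intro x (hx : 0 < x)
  have hKx : ContinuousAt K x := hK.continuousAt (Ioi_mem_nhds hx)
  -- A set of full measure meets every interval, so the two functions agree at points arbitrarily
  -- close to x on either side.
  have dense : ∀ a b : ℝ, a < b → ∃ y ∈ Ioo a b, y ∈ Ioi (0 : ℝ) → φ y = K y := fun a b hab => by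
    by_contra hcon
    push Not at hcon
    have : volume (Ioo a b) = 0 :=
      measure_mono_null (fun y hy => by
        have := hcon y hy
        simpa using this) (ae_iff.1 h)
    simp [Real.volume_Ioo, hab.not_ge] at this
  refine le_antisymm (le_of_forall_pos_le_add fun ε hε => ?_)
    (le_of_forall_pos_le_add fun ε hε => ?_)
  all_goals
    obtain ⟨δ, hδ, hb⟩ := Metric.continuousAt_iff.1 hKx ε hε
  · obtain ⟨y, hy, he⟩ := dense (max (x - δ) 0) x (max_lt (by linarith) hx)
    have hy1 := (le_max_left _ _).trans_lt hy.1
    have hy0 : 0 < y := (le_max_right _ _).trans_lt hy.1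
    have h1 := hφ hy0 hx hy.2.le
    have h2 := hb (x := y) (by rw [Real.dist_eq, abs_lt]; constructor <;> linarith [hy.2])
    rw [Real.dist_eq, abs_lt] at h2
    rw [he hy0] at h1
    linarith [h2.2]
  · obtain ⟨y, hy, he⟩ := dense x (x + δ) (by linarith)
    have hy0 : 0 < y := hx.trans hy.1
    have h1 := hφ hx hy0 hy.1.le
    have h2 := hb (x := y) (by rw [Real.dist_eq, abs_lt]; constructor <;> linarith [hy.2, hy.1])
    rw [Real.dist_eq, abs_lt] at h2
    rw [he hy0] at h1
    linarith [h2.1]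

lemma IsPosTest.mul_pow {η : ℝ → ℝ} (h : IsPosTest η) (n : ℕ) :
    IsPosTest (fun x => η x * x ^ n) :=
  h.mul (contDiff_id.pow n).contDiffOn

lemma IsPosTest.mul_inv_pow {η : ℝ → ℝ} (h : IsPosTest η) (n : ℕ) :
    IsPosTest (fun x => η x * (x ^ n)⁻¹) :=
  h.mul ((contDiff_id.pow n).contDiffOn.inv fun x (hx : 0 < x) => by
    simpa using (pow_pos hx n).ne')

lemma IsPosTest.mul_inv_pow_mul_pow {η : ℝ → ℝ} (h : IsPosTest η) (n : ℕ) (x : ℝ) :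
    η x * (x ^ n)⁻¹ * x ^ n = η x := by
  rcases le_or_gt x 0 with hx | hx
  · simp [h.eq_zero_of_nonpos hx]
  · rw [inv_mul_cancel_right₀ (pow_pos hx n).ne']

/-- An antitone weak solution of `d/dr (r ^ n dφ/dr) = h` on `(0, ∞)` is continuously
differentiable, and `r ^ n dφ/dr` is a primitive of `h`. -/
lemma exists_hasDerivAt_of_weak (n : ℕ) {φ h : ℝ → ℝ} (hφ : AntitoneOn φ (Ioi 0))
    (hh : LocallyIntegrableOn h (Ioi 0))
    (H : ∀ η Z, IsPosTest η → IsPosTest Z → (∀ r, deriv η r * r ^ n = Z r) →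
      ∫ r, φ r * deriv Z r = ∫ r, h r * η r) :
    ∃ c, ∀ r, 0 < r → HasDerivAt φ (((∫ t in (1 : ℝ)..r, h t) + c) / r ^ n) r := by
  have hφL : LocallyIntegrableOn φ (Ioi 0) := by
    rw [locallyIntegrableOn_iff isOpen_Ioi.isLocallyClosed]
    exact fun k hk hkc => (hφ.mono hk).integrableOn_isCompact hkc
  set F : ℝ → ℝ := fun x => ∫ t in (1 : ℝ)..x, h t with hFdef
  have hF : ContinuousOn F (Ioi 0) := continuousOn_primitive hh
  have hFL := hF.locallyIntegrableOn (μ := volume) measurableSet_Ioi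
  obtain ⟨ζ₀, hζ₀, hone⟩ := IsPosTest.exists_integral_eq_one
  have hZ₀ := hζ₀.mul_pow n
  set Z₀ : ℝ → ℝ := fun x => ζ₀ x * x ^ n with hZ₀def
  have hZ₀i : ∫ x, Z₀ x * (x ^ n)⁻¹ = 1 := by
    rw [← hone]
    congr 1; ext x
    rcases le_or_gt x 0 with hx | hx
    · simp [hZ₀def, hζ₀.eq_zero_of_nonpos hx]
    · rw [hZ₀def]; exact mul_inv_cancel_right₀ (pow_pos hx n).ne' _
  -- The equation can only be tested with Z = r^n η'. Such Z are those with ∫ Z/r^n = 0; a general Z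
  -- is corrected by a multiple of Z₀, at the price of the constant c.
  have main : ∀ Z, IsPosTest Z → ∫ x, Z x * (x ^ n)⁻¹ = 0 →
      (∫ x, φ x * deriv Z x) + ∫ x, F x * (Z x * (x ^ n)⁻¹) = 0 := by
    intro Z hZ h0
    obtain ⟨η, hη, hηd⟩ := (hZ.mul_inv_pow n).exists_primitive h0
    have hd : deriv η = fun x => Z x * (x ^ n)⁻¹ := funext fun x => (hηd x).deriv
    rw [H η Z hη hZ fun r => by rw [hd]; exact hZ.mul_inv_pow_mul_pow n r,
      integral_mul_eq_neg_integral_primitive_mul_deriv hh hη, hd]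
    simp [hFdef]
  set c := (∫ x, φ x * deriv Z₀ x) + ∫ x, F x * (Z₀ x * (x ^ n)⁻¹) with hc
  have gen : ∀ Z, IsPosTest Z →
      ∫ x, φ x * deriv Z x = -∫ x, (F x - c) * (Z x * (x ^ n)⁻¹) := by
    intro Z hZ
    set m := ∫ x, Z x * (x ^ n)⁻¹ with hm
    have hmZ := hZ₀.const_mul m
    have e1 : ∫ x, (Z x - m * Z₀ x) * (x ^ n)⁻¹ = 0 := by
      have : ∀ x, (Z x - m * Z₀ x) * (x ^ n)⁻¹ =
          Z x * (x ^ n)⁻¹ - m * (Z₀ x * (x ^ n)⁻¹) := fun x => by ring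
      simp_rw [this]
      rw [integral_sub (hZ.mul_inv_pow n).integrable
        ((hZ₀.mul_inv_pow n).integrable.const_mul m), integral_const_mul, hZ₀i]
      simp [hm]
    have e2 := main _ (hZ.sub hmZ) e1
    have e3 : ∫ x, φ x * deriv (fun x => Z x - m * Z₀ x) x =
        (∫ x, φ x * deriv Z x) - m * ∫ x, φ x * deriv Z₀ x := by
      rw [← integral_const_mul, ← integral_sub (hZ.isPosTest_deriv.integrable_mul hφL)
        ((hZ₀.isPosTest_deriv.integrable_mul hφL).const_mul m)]
      congr 1; ext x
      have hd := (hZ.differentiable x).hasDerivAt.sub ((hZ₀.differentiable x).hasDerivAt.const_mul m)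
      have hd' : deriv (fun x => Z x - m * Z₀ x) x = deriv Z x - m * deriv Z₀ x := hd.deriv
      rw [hd']; ring
    have e4 : ∫ x, F x * ((Z x - m * Z₀ x) * (x ^ n)⁻¹) =
        (∫ x, F x * (Z x * (x ^ n)⁻¹)) - m * ∫ x, F x * (Z₀ x * (x ^ n)⁻¹) := by
      rw [← integral_const_mul, ← integral_sub ((hZ.mul_inv_pow n).integrable_mul hFL)
        (((hZ₀.mul_inv_pow n).integrable_mul hFL).const_mul m)]
      congr 1; ext x; ring
    have e5 : ∫ x, (F x - c) * (Z x * (x ^ n)⁻¹) =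
        (∫ x, F x * (Z x * (x ^ n)⁻¹)) - c * m := by
      rw [hm, ← integral_const_mul, ← integral_sub ((hZ.mul_inv_pow n).integrable_mul hFL)
        ((hZ.mul_inv_pow n).integrable.const_mul c)]
      congr 1; ext x; ring
    rw [e3, e4] at e2
    rw [e5, hc]
    linarith
  set k : ℝ → ℝ := fun x => (F x - c) * (x ^ n)⁻¹ with hk
  have hkc : ContinuousOn k (Ioi 0) := (hF.sub continuousOn_const).mul
    ((continuous_pow n).continuousOn.inv₀ fun x (hx : 0 < x) => (pow_pos hx n).ne')
  have hkL := hkc.locallyIntegrableOn (μ := volume) measurableSet_Ioi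
  have hKd : ∀ x, 0 < x → HasDerivAt (fun x => ∫ t in (1 : ℝ)..x, k t) (k x) x := fun x hx => by
    refine intervalIntegral.integral_hasDerivAt_right ?_
      (hkc.stronglyMeasurableAtFilter isOpen_Ioi x hx) (hkc.continuousAt (Ioi_mem_nhds hx))
    refine (hkc.mono fun y hy => ?_).intervalIntegrable
    exact (lt_min one_pos hx).trans_le hy.1
  have hKc := continuousOn_primitive hkL
  have hKL := hKc.locallyIntegrableOn (μ := volume) measurableSet_Ioi
  -- By `gen`, φ has weak derivative k, so φ minus a primitive of k is constant almost everywhere;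
  -- monotonicity then removes the exceptional set.
  obtain ⟨d, hd⟩ := ae_eq_const_of_integral_mul_deriv_eq_zero (hφL.sub hKL) fun Z hZ => by
    have e : ∀ x, (φ - fun x => ∫ t in (1 : ℝ)..x, k t) x * deriv Z x =
        φ x * deriv Z x - (∫ t in (1 : ℝ)..x, k t) * deriv Z x := fun x => by
      simp only [Pi.sub_apply]; ring
    simp_rw [e]
    rw [integral_sub (hZ.isPosTest_deriv.integrable_mul hφL) (hZ.isPosTest_deriv.integrable_mul hKL),
      gen Z hZ]
    have := integral_mul_eq_neg_integral_primitive_mul_deriv hkL hZ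
    rw [sub_eq_zero, ← neg_eq_iff_eq_neg.2 this, neg_inj]
    congr 1; ext x; simp only [hk]; ring
  have hEq : EqOn φ (fun x => (∫ t in (1 : ℝ)..x, k t) + d) (Ioi 0) := by
    refine eqOn_of_ae_eq_of_antitoneOn hφ (hKc.add continuousOn_const) ?_
    filter_upwards [hd] with x hx hx0
    have := hx hx0
    simp only [Pi.sub_apply] at this
    linarith
  refine ⟨-c, fun r hr => ?_⟩
  have := ((hKd r hr).add_const d).congr_of_eventuallyEq
    (hEq.eventuallyEq_of_mem (Ioi_mem_nhds hr))
  have e : ((∫ t in (1 : ℝ)..r, h t) + -c) / r ^ n = k r := by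
    rw [div_eq_mul_inv, ← sub_eq_add_neg]
  rw [e]
  exact this

/-- The nonlinearity `ω s + s ^ p - s ^ q`, so that the equation reads `Δv = nonlin p q ω v`. -/
noncomputable def nonlin (p q ω s : ℝ) : ℝ := ω * s + s ^ p - s ^ q

lemma continuous_nonlin {p q ω : ℝ} (hp : 0 < p) (hq : 0 < q) : Continuous (nonlin p q ω) :=
  ((continuous_const.mul continuous_id).add (Real.continuous_rpow_const hp.le)).sub
    (Real.continuous_rpow_const hq.le)

/-! ### Radial test functions in ℝ^N -/

section Radial

variable {N : ℕ} {κ η : ℝ → ℝ}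

lemma IsPosTest.eventually_comp_norm_eq_zero (h : IsPosTest κ) :
    (fun x : Space N => κ ‖x‖) =ᶠ[𝓝 0] fun _ => 0 := by
  have h0 : Tendsto (fun x : Space N => ‖x‖) (𝓝 0) (𝓝 0) := tendsto_norm_zero
  exact h0.eventually (h.eventually_eq_zero le_rfl)

lemma IsPosTest.isTestFunction_comp_norm (h : IsPosTest κ) :
    IsTestFunction (fun x : Space N => κ ‖x‖) := by
  refine ⟨contDiff_iff_contDiffAt.2 fun x => ?_, ?_⟩
  · by_cases hx : x = 0
    · subst hx
      exact contDiffAt_const.congr_of_eventuallyEq h.eventually_comp_norm_eq_zero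
    · exact h.contDiff.contDiffAt.comp x (contDiffAt_norm ℝ hx)
  · obtain ⟨a, b, -, -, h0⟩ := h.support
    refine HasCompactSupport.intro (isCompact_closedBall (0 : Space N) b) fun x hx => h0 _ ?_
    rw [mem_closedBall_zero_iff] at hx
    exact fun h => hx h.2

lemma IsTestFunction.mul_coord {ψ : Space N → ℝ} (h : IsTestFunction ψ) (i : Fin N) :
    IsTestFunction (fun x => ψ x * x i) :=
  ⟨h.1.mul (EuclideanSpace.proj (𝕜 := ℝ) i).contDiff, h.2.mul_right⟩

lemma IsPosTest.partialDeriv_comp_norm (h : IsPosTest κ) (i : Fin N) (x : Space N) :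
    partialDeriv i (fun x : Space N => κ ‖x‖) x = deriv κ ‖x‖ * ‖x‖⁻¹ * x i := by
  unfold partialDeriv
  by_cases hx : x = 0
  · subst hx
    rw [h.eventually_comp_norm_eq_zero.fderiv_eq]
    simp
  · have hx0 : 0 < ‖x‖ := norm_pos_iff.2 hx
    have h1 : HasFDerivAt (fun x : Space N => ‖x‖ ^ 2) (2 • innerSL ℝ x) x :=
      (hasStrictFDerivAt_norm_sq x).hasFDerivAt
    have h2 := h1.sqrt (by positivity)
    simp only [Real.sqrt_sq (norm_nonneg _)] at h2
    have h3 := (h.differentiable ‖x‖).hasDerivAt.comp_hasFDerivAt x h2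
    have h4 : HasFDerivAt (fun x : Space N => κ ‖x‖) _ x := h3
    rw [h4.fderiv]
    simp only [smul_apply, innerSL_apply_apply,
      EuclideanSpace.inner_single_right, smul_eq_mul, nsmul_eq_mul]
    simp
    field_simp

lemma partialDeriv_mul_coord {ψ : Space N → ℝ} (h : IsTestFunction ψ) (i : Fin N) (x : Space N) :
    partialDeriv i (fun x => ψ x * x i) x = partialDeriv i ψ x * x i + ψ x := by
  unfold partialDeriv
  have h1 : HasFDerivAt (fun x : Space N => x i) (EuclideanSpace.proj (𝕜 := ℝ) i) x :=
    (EuclideanSpace.proj (𝕜 := ℝ) i).hasFDerivAt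
  have h2 := ((h.1.differentiable (by simp)) x).hasFDerivAt.mul h1
  have h3 : HasFDerivAt (fun x => ψ x * x i) _ x := h2
  rw [h3.fderiv]
  simp
  ring

lemma IsTestFunction.integrable_mul {ψ : Space N → ℝ} (h : IsTestFunction ψ) {g : Space N → ℂ}
    (hg : LocallyIntegrable g) : Integrable (fun x => g x * (ψ x : ℂ)) := by
  have := hg.integrable_smul_left_of_hasCompactSupport h.1.continuous h.2
  simpa only [Complex.real_smul, mul_comm] using this

lemma IsTestFunction.isTestFunction_partialDeriv {ψ : Space N → ℝ} (h : IsTestFunction ψ)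
    (i : Fin N) : IsTestFunction (partialDeriv i ψ) := by
  refine ⟨?_, ?_⟩
  · exact (h.1.fderiv_right (m := ((⊤ : ℕ∞) : WithTop ℕ∞)) (by simp)).clm_apply contDiff_const
  · exact h.2.fderiv_apply ℝ _

end Radial

/-- Extending φ by the constant φ 0 to the negative axis gives a monotone function on the whole
line, hence a measurable one. -/
lemma antitone_comp_max {φ : ℝ → ℝ} (hφ : AntitoneOn φ (Ici 0)) :
    Antitone fun r => φ (max r 0) := fun a b hab =>
  hφ (le_max_right a 0) (le_max_right b 0) (max_le_max_right 0 hab)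

/-! ### The weak equation in polar coordinates -/

section Weak

variable {N : ℕ} {p q ω : ℝ} {φ : ℝ → ℝ}

lemma exists_bound_nonlin_comp (hp : 0 < p) (hq : 0 < q) (hpos : ∀ r, 0 ≤ r → 0 < φ r)
    (hφ : AntitoneOn φ (Ici 0)) : ∃ M, ∀ r, 0 ≤ r → |nonlin p q ω (φ r)| ≤ M := by
  obtain ⟨M, hM⟩ := (isCompact_Icc (a := 0) (b := φ 0)).exists_bound_of_continuousOn
    (continuous_nonlin (ω := ω) hp hq).continuousOn
  exact ⟨M, fun r hr => hM _ ⟨(hpos r hr).le, hφ (mem_Ici.2 le_rfl) hr hr⟩⟩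

lemma measurable_nonlin_comp (hp : 0 < p) (hq : 0 < q) (hφ : AntitoneOn φ (Ici 0)) :
    Measurable fun r => nonlin p q ω (φ (max r 0)) :=
  (continuous_nonlin hp hq).measurable.comp (antitone_comp_max hφ).measurable

lemma locallyIntegrableOn_pow_mul_nonlin (n : ℕ) (hp : 0 < p) (hq : 0 < q)
    (hpos : ∀ r, 0 ≤ r → 0 < φ r) (hφ : AntitoneOn φ (Ici 0)) :
    LocallyIntegrableOn (fun r => r ^ n * nonlin p q ω (φ r)) (Ioi 0) := by
  obtain ⟨M, hM⟩ := exists_bound_nonlin_comp (ω := ω) hp hq hpos hφ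
  rw [locallyIntegrableOn_iff isOpen_Ioi.isLocallyClosed]
  intro k hk hkc
  have h1 : IntegrableOn (fun r : ℝ => r ^ n) k :=
    (continuous_pow n).continuousOn.integrableOn_compact hkc
  have h2 : IntegrableOn (fun r : ℝ => r ^ n * nonlin p q ω (φ (max r 0))) k :=
    h1.mul_bdd (c := M) (measurable_nonlin_comp hp hq hφ).aestronglyMeasurable
      (ae_of_all _ fun r => hM _ (le_max_right _ _))
  refine h2.congr_fun (fun r hr => ?_) hkc.measurableSet
  simp only [max_eq_left (le_of_lt (mem_Ioi.1 (hk hr)))]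

/-- The weak equation tested with radial functions. -/
lemma integral_mul_deriv_eq_of_isWeakSolution {n : ℕ} (hp : 1 < p) (hq : 1 < q)
    (hpos : ∀ r, 0 ≤ r → 0 < φ r) (hφ : AntitoneOn φ (Ici 0))
    (hgrad : HasWeakGradient (fun x : Space (n + 1) => (φ ‖x‖ : ℂ))
      (weakGradient fun x : Space (n + 1) => (φ ‖x‖ : ℂ)))
    (hsol : IsWeakSolution p q ω (fun x : Space (n + 1) => (φ ‖x‖ : ℂ)))
    {η Z : ℝ → ℝ} (hη : IsPosTest η) (hZ : IsPosTest Z) (hηZ : ∀ r, deriv η r * r ^ n = Z r) :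
    ∫ r, φ r * deriv Z r = ∫ r, (r ^ n * nonlin p q ω (φ r)) * η r := by
  set v : Space (n + 1) → ℂ := fun x => (φ ‖x‖ : ℂ) with hv
  set G := weakGradient v with hG
  obtain ⟨hvL, hGL, hIBP⟩ := hgrad
  -- Here κ = Z/r^(n+1) = η'/r, so ∂_i of η(|x|) is κ(|x|) x_i, again a test function.
  have hκ := hZ.mul_inv_pow (n + 1)
  have hκZ := hZ.mul_inv_pow_mul_pow (n + 1)
  set κ : ℝ → ℝ := fun r => Z r * (r ^ (n + 1))⁻¹ with hκdef
  have hψ : IsTestFunction (fun x : Space (n + 1) => η ‖x‖) := hη.isTestFunction_comp_norm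
  have hκψ : IsTestFunction (fun x : Space (n + 1) => κ ‖x‖) := hκ.isTestFunction_comp_norm
  have hd1 : ∀ i : Fin (n + 1), partialDeriv i (fun x : Space (n + 1) => η ‖x‖) =
      fun x => κ ‖x‖ * x i := fun i => by
    ext x
    rw [hη.partialDeriv_comp_norm]
    by_cases hx : x = 0
    · simp [hx]
    · have hx0 : ‖x‖ ≠ 0 := norm_ne_zero_iff.2 hx
      simp only [hκdef, ← hηZ]
      field_simp
      ring
  have hd2 : ∀ (i : Fin (n + 1)) (x : Space (n + 1)), partialDeriv i (fun x => κ ‖x‖ * x i) x =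
      deriv κ ‖x‖ * ‖x‖⁻¹ * x i ^ 2 + κ ‖x‖ := fun i x => by
    rw [partialDeriv_mul_coord hκψ, hκ.partialDeriv_comp_norm]; ring
  have hlap : ∀ x : Space (n + 1), ∑ i, (deriv κ ‖x‖ * ‖x‖⁻¹ * x i ^ 2 + κ ‖x‖) =
      ‖x‖ * deriv κ ‖x‖ + (n + 1) * κ ‖x‖ := fun x => by
    rw [Finset.sum_add_distrib, ← Finset.mul_sum, ← EuclideanSpace.real_norm_sq_eq]
    simp only [Finset.sum_const, Finset.card_univ, Fintype.card_fin, nsmul_eq_mul]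
    push_cast
    by_cases hx : x = 0
    · simp [hx]
    · have hx0 : ‖x‖ ≠ 0 := norm_ne_zero_iff.2 hx
      field_simp
  obtain ⟨M, hM⟩ := exists_bound_nonlin_comp (ω := ω) (one_pos.trans hp) (one_pos.trans hq) hpos hφ
  have hmeas : Measurable fun x : Space (n + 1) => nonlin p q ω (φ ‖x‖) := by
    have := (measurable_nonlin_comp (ω := ω) (one_pos.trans hp) (one_pos.trans hq) hφ).comp
      (measurable_norm (α := Space (n + 1)))
    simpa only [Function.comp_def, max_eq_left (norm_nonneg _)] using this
  have hfI : Integrable fun x : Space (n + 1) => nonlin p q ω (φ ‖x‖) * η ‖x‖ :=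
    (hψ.1.continuous.integrable_of_hasCompactSupport hψ.2).bdd_mul (c := M)
      hmeas.aestronglyMeasurable (ae_of_all _ fun x => hM _ (norm_nonneg _))
  have hs := hsol _ hψ
  rw [← hG] at hs
  have hnl : ∀ x : Space (n + 1),
      ((ω : ℂ) * v x + ((‖v x‖ ^ (p - 1) : ℝ) : ℂ) * v x - ((‖v x‖ ^ (q - 1) : ℝ) : ℂ) * v x) *
        (η ‖x‖ : ℂ) = ((nonlin p q ω (φ ‖x‖) * η ‖x‖ : ℝ) : ℂ) := fun x => by
    have hφx := hpos ‖x‖ (norm_nonneg _)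
    have hnorm : ‖v x‖ = φ ‖x‖ := by simp [hv, abs_of_pos hφx]
    have e : ∀ s : ℝ, φ ‖x‖ ^ s = φ ‖x‖ ^ (s - 1) * φ ‖x‖ := fun s => by
      conv_lhs => rw [← sub_add_cancel s 1]
      rw [Real.rpow_add_one hφx.ne']
    rw [hnorm, nonlin, e p, e q]
    simp only [hv]
    push_cast
    ring
  simp_rw [hnl] at hs
  have hGi : ∀ i, Integrable fun x => G i x *
      (partialDeriv i (fun x : Space (n + 1) => η ‖x‖) x : ℂ) := fun i =>
    (hψ.isTestFunction_partialDeriv i).integrable_mul (hGL i)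
  have hfC : Integrable fun x : Space (n + 1) =>
      ((nonlin p q ω (φ ‖x‖) * η ‖x‖ : ℝ) : ℂ) := hfI.ofReal
  rw [integral_add (integrable_finsetSum _ fun i _ => hGi i) hfC,
    integral_finsetSum _ fun i _ => hGi i] at hs
  have hvi : ∀ i, Integrable fun x => v x *
      (partialDeriv i (fun x : Space (n + 1) => κ ‖x‖ * x i) x : ℂ) := fun i =>
    ((hκψ.mul_coord i).isTestFunction_partialDeriv i).integrable_mul hvL
  -- The definition of the weak gradient, with κ(|x|) x_i as test function, moves the derivative
  -- back from G onto the test function and leaves v against the Laplacian of η(|x|).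
  have hflip : ∀ i, ∫ x, G i x * (partialDeriv i (fun x : Space (n + 1) => η ‖x‖) x : ℂ) =
      -∫ x, v x * (partialDeriv i (fun x : Space (n + 1) => κ ‖x‖ * x i) x : ℂ) := fun i => by
    rw [hd1 i, hIBP i _ (hκψ.mul_coord i), neg_neg]
  simp_rw [hflip] at hs
  rw [Finset.sum_neg_distrib, ← integral_finsetSum _ fun i _ => hvi i] at hs
  have hsum : ∀ x, ∑ i, v x * (partialDeriv i (fun x : Space (n + 1) => κ ‖x‖ * x i) x : ℂ) =
      ((φ ‖x‖ * (‖x‖ * deriv κ ‖x‖ + (n + 1) * κ ‖x‖) : ℝ) : ℂ) := fun x => by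
    rw [← Finset.mul_sum, ← Complex.ofReal_sum]
    simp_rw [hd2]
    rw [hlap, hv, ← Complex.ofReal_mul]
  simp_rw [hsum] at hs
  rw [integral_complex_ofReal, integral_complex_ofReal, ← Complex.ofReal_neg, ← Complex.ofReal_add,
    Complex.ofReal_eq_zero] at hs
  have hpol := fun f : ℝ → ℝ => integral_fun_norm_addHaar (volume : Measure (Space (n + 1))) f
  rw [hpol (fun r => φ r * (r * deriv κ r + (n + 1) * κ r)),
    hpol (fun r => nonlin p q ω (φ r) * η r)] at hs
  simp only [finrank_euclideanSpace, Fintype.card_fin, Nat.add_sub_cancel, smul_eq_mul,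
    nsmul_eq_mul] at hs
  have hball : 0 < (volume : Measure (Space (n + 1))).real (Metric.ball 0 1) :=
    ENNReal.toReal_pos (Metric.measure_ball_pos _ _ one_pos).ne' measure_ball_lt_top.ne
  have hkey : ∫ r in Ioi (0 : ℝ), r ^ n * (φ r * (r * deriv κ r + (n + 1) * κ r)) =
      ∫ r in Ioi (0 : ℝ), r ^ n * (nonlin p q ω (φ r) * η r) := by
    have hc : (((n + 1 : ℕ) : ℝ) * (volume : Measure (Space (n + 1))).real (Metric.ball 0 1)) ≠ 0 :=
      mul_ne_zero (by positivity) hball.ne'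
    refine mul_left_cancel₀ hc ?_
    linarith
  -- The left side is the product rule for (κ r^(n+1))', and κ r^(n+1) = Z.
  have hZd : ∀ r, 0 < r → r ^ n * (r * deriv κ r + (n + 1) * κ r) = deriv Z r := fun r hr => by
    have h1 := (hκ.differentiable r).hasDerivAt.mul (hasDerivAt_pow (n + 1) r)
    have h2 : Z = fun r => κ r * r ^ (n + 1) := funext fun r => (hκZ r).symm
    have h3 : deriv (fun r => κ r * r ^ (n + 1)) r = _ := h1.deriv
    conv_rhs => rw [h2]
    rw [h3]
    push_cast
    ring
  rw [← setIntegral_eq_integral_of_forall_compl_eq_zero (s := Ioi 0) (f := fun r => φ r * deriv Z r)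
      fun r hr => by rw [hZ.isPosTest_deriv.eq_zero_of_nonpos (not_lt.1 hr), mul_zero],
    ← setIntegral_eq_integral_of_forall_compl_eq_zero (s := Ioi 0)
      (f := fun r => (r ^ n * nonlin p q ω (φ r)) * η r)
      fun r hr => by rw [hη.eq_zero_of_nonpos (not_lt.1 hr), mul_zero]]
  calc ∫ r in Ioi 0, φ r * deriv Z r
      = ∫ r in Ioi (0 : ℝ), r ^ n * (φ r * (r * deriv κ r + (n + 1) * κ r)) :=
        setIntegral_congr_fun measurableSet_Ioi fun r hr => by
          simp only [← hZd r hr]; ring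
    _ = _ := hkey
    _ = _ := by congr 1; ext r; ring

/-- Profiles of solutions tend to zero, by integrability. -/
lemma tendsto_zero_of_memLp [Nonempty (Fin N)] (hpos : ∀ r, 0 ≤ r → 0 < φ r)
    (hφ : AntitoneOn φ (Ici 0)) {s : ENNReal} (hs : s ≠ 0) (hs' : s ≠ ⊤)
    (h : MemLp (fun x : Space N => (φ ‖x‖ : ℂ)) s) : Tendsto φ atTop (𝓝 0) := by
  rw [Metric.tendsto_atTop]
  intro ε hε
  by_contra hcon
  push Not at hcon
  have hge : ∀ r, 0 ≤ r → ε ≤ φ r := fun r hr => by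
    obtain ⟨t, ht, hd⟩ := hcon r
    rw [Real.dist_eq, sub_zero, abs_of_pos (hpos t (hr.trans ht))] at hd
    exact hd.trans (hφ hr (hr.trans ht) ht)
  have : MemLp (fun _ : Space N => ε) s := h.mono aestronglyMeasurable_const
    (ae_of_all _ fun x => by
      have := hpos ‖x‖ (norm_nonneg _)
      simpa [abs_of_pos hε, abs_of_pos this] using hge ‖x‖ (norm_nonneg _))
  rw [memLp_const_iff hs hs', measure_univ_of_isAddLeftInvariant] at this
  simp [hε.ne'] at this

end Weak

/-! ### The radial first order system -/

/-- A positive decreasing solution, vanishing at infinity, of the radial equation in dimension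
`n + 1`, written as a first order system for `φ` and the flux `w = - r ^ n dφ/dr`. -/
structure IsRadialSolution (n : ℕ) (p q ω : ℝ) (φ w : ℝ → ℝ) : Prop where
  pos : ∀ r, 0 < r → 0 < φ r
  anti : AntitoneOn φ (Ioi 0)
  flux_nonneg : ∀ r, 0 < r → 0 ≤ w r
  hasDerivAt : ∀ r, 0 < r → HasDerivAt φ (-(w r / r ^ n)) r
  hasDerivAt_flux : ∀ r, 0 < r → HasDerivAt w (-(r ^ n * nonlin p q ω (φ r))) r
  tendsto : Tendsto φ atTop (𝓝 0)

/-- The flux is minus the primitive of r^n times the nonlinearity, shifted by the constant from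
`exists_hasDerivAt_of_weak`. Its sign comes from monotonicity of φ, and the limit at infinity from
L² when ω > 0 and from L^(p+1) when ω = 0. -/
lemma IsGroundStateProfile.exists_isRadialSolution {n : ℕ} {p q ω : ℝ} {φ : ℝ → ℝ} (hp : 1 < p)
    (hq : 1 < q) (hω : 0 ≤ ω) (h : IsGroundStateProfile (n + 1) p q ω φ) :
    ∃ w, IsRadialSolution n p q ω φ w := by
  obtain ⟨hpos, hφ, ⟨⟨⟨hgrad, -, hL2, hLp⟩, -, hsol⟩, -⟩⟩ := h
  have hφ' : AntitoneOn φ (Ioi 0) := hφ.mono Ioi_subset_Ici_self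
  obtain ⟨c, hc⟩ := exists_hasDerivAt_of_weak n hφ'
    (locallyIntegrableOn_pow_mul_nonlin (ω := ω) n (one_pos.trans hp) (one_pos.trans hq) hpos hφ)
    fun η Z hη hZ hηZ =>
      integral_mul_deriv_eq_of_isWeakSolution hp hq hpos hφ hgrad hsol hη hZ hηZ
  have hφc : ContinuousOn φ (Ioi 0) := fun r hr => (hc r hr).continuousAt.continuousWithinAt
  have hhc : ContinuousOn (fun r => r ^ n * nonlin p q ω (φ r)) (Ioi 0) :=
    (continuous_pow n).continuousOn.mul
      ((continuous_nonlin (one_pos.trans hp) (one_pos.trans hq)).comp_continuousOn hφc)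
  refine ⟨fun r => -((∫ t in (1 : ℝ)..r, t ^ n * nonlin p q ω (φ t)) + c),
    fun r hr => hpos r hr.le, hφ', fun r hr => ?_, fun r hr => ?_, fun r hr => ?_, ?_⟩
  · have hle : ((∫ t in (1 : ℝ)..r, t ^ n * nonlin p q ω (φ t)) + c) / r ^ n ≤ 0 := by
      rw [← (hc r hr).deriv, ← derivWithin_of_isOpen isOpen_Ioi hr]
      exact hφ'.derivWithin_nonpos
    have := mul_nonpos_of_nonpos_of_nonneg hle (pow_pos hr n).le
    rw [div_mul_cancel₀ _ (pow_pos hr n).ne'] at this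
    linarith
  · rw [neg_div, neg_neg]; exact hc r hr
  · refine HasDerivAt.neg (HasDerivAt.add_const c ?_)
    refine intervalIntegral.integral_hasDerivAt_right ?_
      (hhc.stronglyMeasurableAtFilter isOpen_Ioi r hr) (hhc.continuousAt (Ioi_mem_nhds hr))
    exact (hhc.mono fun y hy => (lt_min one_pos hr).trans_le hy.1).intervalIntegrable
  · rcases hω.eq_or_lt with h0 | h0
    · exact tendsto_zero_of_memLp hpos hφ (by simp; linarith) (by simp) (hLp h0.symm)
    · exact tendsto_zero_of_memLp hpos hφ (by simp) (by simp) (hL2 h0)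

/-! ### Comparison and threshold inequalities -/

/-- Comparison for the differential inequality `dy/dr ≤ -κ y ^ m dh/dr` with `m > 1`. -/
lemma le_rpow_of_deriv_le {y y' h h' : ℝ → ℝ} {a b m κ : ℝ} (hab : a < b) (hm : 1 < m)
    (hy : ∀ r ∈ Icc a b, 0 < y r) (hyd : ∀ r ∈ Icc a b, HasDerivAt y (y' r) r)
    (hhd : ∀ r ∈ Icc a b, HasDerivAt h (h' r) r)
    (hle : ∀ r ∈ Icc a b, y' r ≤ -(κ * y r ^ m * h' r)) :
    (m - 1) * κ * (h b - h a) ≤ y b ^ (1 - m) := by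
  -- Since (y^(1-m))' = -(m-1) y^(-m) y' ≥ (m-1) κ h', this difference is nondecreasing.
  have hd : ∀ r ∈ Icc a b, HasDerivAt (fun r => y r ^ (1 - m) - (m - 1) * κ * h r)
      (y' r * (1 - m) * y r ^ (1 - m - 1) - (m - 1) * κ * h' r) r := fun r hr =>
    ((hyd r hr).rpow_const (Or.inl (hy r hr).ne')).sub ((hhd r hr).const_mul _)
  have hmono : MonotoneOn (fun r => y r ^ (1 - m) - (m - 1) * κ * h r) (Icc a b) := by
    refine monotoneOn_of_hasDerivWithinAt_nonneg (convex_Icc a b)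
      (fun r hr => (hd r hr).continuousAt.continuousWithinAt)
      (fun r hr => (hd r (interior_subset hr)).hasDerivWithinAt) fun r hr => ?_
    have hr' := interior_subset hr
    have hyr := hy r hr'
    have e : y r ^ m * y r ^ (1 - m - 1) = 1 := by
      rw [← Real.rpow_add hyr]; simp
    have h1 : 0 < y r ^ (1 - m - 1) := Real.rpow_pos_of_pos hyr _
    have h2 := mul_le_mul_of_nonneg_right (hle r hr') (mul_pos (sub_pos.2 hm) h1).le
    have h3 : -(κ * y r ^ m * h' r) * ((m - 1) * y r ^ (1 - m - 1)) =
        -((m - 1) * κ * h' r) := by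
      calc _ = -((m - 1) * κ * h' r) * (y r ^ m * y r ^ (1 - m - 1)) := by ring
        _ = _ := by rw [e, mul_one]
    rw [h3] at h2
    linarith
  have := hmono (left_mem_Icc.2 hab.le) (right_mem_Icc.2 hab.le) hab.le
  have hpos : 0 < y a ^ (1 - m) := Real.rpow_pos_of_pos (hy a (left_mem_Icc.2 hab.le)) _
  simp only at this
  linarith

/-- A lower bound on a negative power is an upper bound on the base. -/
lemma le_rpow_neg_of_le_rpow {x t m : ℝ} (hx : 0 < x) (ht : 0 < t) (hm : 1 < m)
    (h : t ≤ x ^ (1 - m)) : x ≤ t ^ (-(1 / (m - 1))) := by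
  have hm' : m - 1 ≠ 0 := (sub_pos.2 hm).ne'
  have h1 := Real.rpow_le_rpow_of_nonpos ht h
    (neg_nonpos.2 (one_div_pos.2 (sub_pos.2 hm)).le : -(1 / (m - 1)) ≤ 0)
  rwa [← Real.rpow_mul hx.le, show (1 - m) * -(1 / (m - 1)) = 1 by field_simp; ring,
    Real.rpow_one] at h1

/-- A constant separating, uniformly in `ω`, the range where the focusing term dominates from the
range where the potential energy is negative. -/
lemma exists_threshold {p q : ℝ} (hp : 1 < p) (hpq : p < q) :
    ∃ c : ℝ, 0 < c ∧ 1 ≤ (1 - c) * (q + 1) * (1 / (p + 1) - c) ∧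
      2 ≤ (1 - c) * (q + 1) := by
  -- At c = 0 the two conditions read (q+1)/(p+1) > 1 and q + 1 > 2; both are strict, so they
  -- survive for small c > 0.
  have h1 : ∀ᶠ c in 𝓝 (0 : ℝ), 1 < (1 - c) * (q + 1) * (1 / (p + 1) - c) := by
    have : ContinuousAt (fun c : ℝ => (1 - c) * (q + 1) * (1 / (p + 1) - c)) 0 := by fun_prop
    refine this.eventually_const_lt ?_
    have : 0 < p + 1 := by linarith
    simp only [sub_zero, one_mul]
    rw [mul_one_div, one_lt_div this]
    linarith
  have h2 : ∀ᶠ c in 𝓝 (0 : ℝ), 2 < (1 - c) * (q + 1) := by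
    have : ContinuousAt (fun c : ℝ => (1 - c) * (q + 1)) 0 := by fun_prop
    refine this.eventually_const_lt ?_
    simp only [sub_zero, one_mul]
    linarith
  obtain ⟨c, ⟨hc1, hc2⟩, hc0⟩ :=
    ((h1.and h2).filter_mono nhdsWithin_le_nhds |>.and
      (self_mem_nhdsWithin (a := (0 : ℝ)) (s := Ioi 0))).exists
  exact ⟨c, hc0, hc1.le, hc2.le⟩

section Threshold

variable {c p q ω s t : ℝ}

/-- The set of heights at which the focusing term dominates is upward closed. -/
lemma dominated_mono (hp : 1 < p) (hpq : p < q) (hω : 0 ≤ ω) (hs : 0 < s) (hst : s ≤ t)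
    (h : s ^ p + ω * s ≤ (1 - c) * s ^ q) : t ^ p + ω * t ≤ (1 - c) * t ^ q := by
  have hx : 1 ≤ t / s := (one_le_div hs).2 hst
  have hx0 : 0 < t / s := one_pos.trans_le hx
  have ht : t = s * (t / s) := by field_simp
  set x := t / s
  rw [ht, Real.mul_rpow hs.le hx0.le, Real.mul_rpow hs.le hx0.le]
  have h1 : x ^ p ≤ x ^ q := Real.rpow_le_rpow_of_exponent_le hx hpq.le
  have h2 : x ≤ x ^ q := by
    simpa using Real.rpow_le_rpow_of_exponent_le hx (hp.trans hpq).le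
  calc s ^ p * x ^ p + ω * (s * x) ≤ s ^ p * x ^ q + ω * (s * x ^ q) := by
        have := Real.rpow_nonneg hs.le p
        gcongr
    _ = (s ^ p + ω * s) * x ^ q := by ring
    _ ≤ (1 - c) * s ^ q * x ^ q := by gcongr
    _ = _ := by ring

lemma one_lt_of_dominated (hpq : p < q) (hω : 0 ≤ ω) (hs : 0 < s) (hc : 0 < c)
    (h : s ^ p + ω * s ≤ (1 - c) * s ^ q) : 1 < s := by
  by_contra hs1
  have h1 := Real.rpow_le_rpow_of_exponent_ge hs (not_lt.1 hs1) hpq.le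
  have h2 := Real.rpow_pos_of_pos hs q
  nlinarith [mul_nonneg hω hs.le]

/-- With A = (1-c)(q+1), the hypothesis bounds s^q/(q+1) by (s^p + ωs)/A. The threshold conditions
say 1/A ≤ 1/(p+1) - c and 1/A ≤ 1/2, so the other two potential terms absorb it with c s^(p+1) to
spare. -/
lemma potential_lower_bound (hp : 1 < p) (hpq : p < q) (hω : 0 ≤ ω) (hs : 0 < s)
    (hc2 : 1 ≤ (1 - c) * (q + 1) * (1 / (p + 1) - c)) (hc3 : 2 ≤ (1 - c) * (q + 1))
    (h : (1 - c) * s ^ q ≤ s ^ p + ω * s) :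
    c * s ^ (p + 1) ≤ ω / 2 * s ^ 2 + s ^ (p + 1) / (p + 1) - s ^ (q + 1) / (q + 1) := by
  have hq1 : 0 < q + 1 := by linarith
  set A := (1 - c) * (q + 1) with hA
  have hA0 : 0 < A := by linarith
  have e1 : s ^ (p + 1) = s ^ p * s := Real.rpow_add_one hs.ne' p
  have e2 : s ^ (q + 1) = s ^ q * s := Real.rpow_add_one hs.ne' q
  have hsp := Real.rpow_pos_of_pos hs p
  have h1 : s ^ q / (q + 1) ≤ (s ^ p + ω * s) / A := by
    rw [div_le_div_iff₀ hq1 hA0, hA]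
    nlinarith
  have h2 : s ^ p / A ≤ s ^ p * (1 / (p + 1) - c) := by
    rw [div_le_iff₀ hA0]
    nlinarith
  have h3 : ω * s / A ≤ ω * s / 2 := by
    have := mul_nonneg hω hs.le
    gcongr
  rw [e1, e2]
  have h4 : s ^ q / (q + 1) ≤ s ^ p * (1 / (p + 1) - c) + ω * s / 2 := by
    calc _ ≤ _ := h1
      _ = s ^ p / A + ω * s / A := by ring
      _ ≤ _ := add_le_add h2 h3
  have h5 := mul_le_mul_of_nonneg_right h4 hs.le
  have e3 : s ^ q / (q + 1) * s = s ^ q * s / (q + 1) := by ring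
  have e4 : (s ^ p * (1 / (p + 1) - c) + ω * s / 2) * s =
      s ^ p * s / (p + 1) - c * (s ^ p * s) + ω / 2 * s ^ 2 := by ring
  rw [e3, e4] at h5
  linarith

end Threshold

/-! ### Energy and decay at rate 2/(p-1) -/

namespace IsRadialSolution

variable {n : ℕ} {p q ω : ℝ} {φ w : ℝ → ℝ}

/-- Beyond a radius independent of `ω`, the focusing term no longer dominates. -/
lemma not_dominated (h : IsRadialSolution n p q ω φ w) (hp : 1 < p) (hpq : p < q) (hω : 0 ≤ ω)
    {c r : ℝ} (hc : 0 < c) (hr : 1 + 1 / ((q - 1) * (c / 2 ^ (n + 1))) < r) :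
    (1 - c) * φ r ^ q < φ r ^ p + ω * φ r := by
  by_contra hcon
  have hq1 : 0 < q - 1 := by linarith
  have hk : 0 < c / 2 ^ (n + 1) := by positivity
  have hr1 : 1 < r := lt_of_le_of_lt (le_add_of_nonneg_right (by positivity)) hr
  have hdom : ∀ s, 0 < s → s ≤ r → φ s ^ p + ω * φ s ≤ (1 - c) * φ s ^ q := fun s hs hsr =>
    dominated_mono hp hpq hω (h.pos r (by linarith)) (h.anti hs (mem_Ioi.2 (by linarith)) hsr)
      (not_lt.1 hcon)
  -- Integrating w' over [s/2, s], where φ ≥ φ(s), gives w(s) ≥ c 2^(-(n+1)) φ(s)^q s^(n+1); one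
  -- factor s ≥ 1 is then dropped.
  have hflux : ∀ s ∈ Icc 1 r, c / 2 ^ (n + 1) * φ s ^ q * s ^ n ≤ w s := fun s hs => by
    have hs0 : 0 < s := by linarith [hs.1]
    have hφs := h.pos s hs0
    have hderiv : ∀ t ∈ interior (Icc (s / 2) s), c * (s / 2) ^ n * φ s ^ q ≤ deriv w t := by
      intro t ht
      rw [interior_Icc] at ht
      have ht0 : 0 < t := by linarith [ht.1]
      rw [(h.hasDerivAt_flux t ht0).deriv]
      have h1 := hdom t ht0 (by linarith [ht.2, hs.2])
      have h2 : φ s ^ q ≤ φ t ^ q := Real.rpow_le_rpow hφs.le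
        (h.anti (mem_Ioi.2 ht0) (mem_Ioi.2 hs0) ht.2.le) (by linarith)
      have h3 : (s / 2) ^ n ≤ t ^ n := pow_le_pow_left₀ (by linarith) ht.1.le n
      have h4 : c * φ t ^ q ≤ -nonlin p q ω (φ t) := by unfold nonlin; linarith
      calc c * (s / 2) ^ n * φ s ^ q = (s / 2) ^ n * (c * φ s ^ q) := by ring
        _ ≤ t ^ n * (c * φ t ^ q) := by
          have := Real.rpow_nonneg hφs.le q
          gcongr
        _ ≤ t ^ n * -nonlin p q ω (φ t) := by gcongr
        _ = _ := by ring
    have hcont : ContinuousOn w (Icc (s / 2) s) := fun t ht =>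
      (h.hasDerivAt_flux t (by linarith [ht.1])).continuousAt.continuousWithinAt
    have hdiff : DifferentiableOn ℝ w (interior (Icc (s / 2) s)) := fun t ht =>
      (h.hasDerivAt_flux t (by
        rw [interior_Icc] at ht; linarith [ht.1])).differentiableAt.differentiableWithinAt
    have hmv := (convex_Icc (s / 2) s).mul_sub_le_image_sub_of_le_deriv hcont hdiff hderiv (s / 2)
      (left_mem_Icc.2 (by linarith)) s (right_mem_Icc.2 (by linarith)) (by linarith)
    have hw0 := h.flux_nonneg (s / 2) (by linarith)
    have e : c * (s / 2) ^ n * φ s ^ q * (s - s / 2) =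
        c / 2 ^ (n + 1) * φ s ^ q * s ^ n * s := by
      rw [div_pow, pow_succ]; field_simp; ring
    rw [e] at hmv
    have hnn : 0 ≤ c / 2 ^ (n + 1) * φ s ^ q * s ^ n := by
      have := Real.rpow_nonneg hφs.le q
      positivity
    nlinarith [hs.1]
  have hcmp := le_rpow_of_deriv_le (y := φ) (h := fun r => r) (h' := fun _ => 1) (a := 1) (b := r)
    (m := q) (κ := c / 2 ^ (n + 1)) hr1 (by linarith) (fun s hs => h.pos s (by linarith [hs.1]))
    (fun s hs => h.hasDerivAt s (by linarith [hs.1])) (fun s _ => hasDerivAt_id s)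
    (fun s hs => by
      have hs0 : 0 < s := by linarith [hs.1]
      rw [mul_one, neg_le_neg_iff, le_div_iff₀ (pow_pos hs0 n)]
      exact hflux s hs)
  -- Domination forces height above 1, so φ(r)^(1-q) ≤ 1, which caps the length r - 1 allowed by
  -- `hcmp`.
  have hφr : 1 < φ r := one_lt_of_dominated hpq hω (h.pos r (by linarith)) hc (not_lt.1 hcon)
  have hle : φ r ^ (1 - q) ≤ 1 := Real.rpow_le_one_of_one_le_of_nonpos hφr.le (by linarith)
  have hprod : 0 < (q - 1) * (c / 2 ^ (n + 1)) := mul_pos hq1 hk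
  have : 1 < (q - 1) * (c / 2 ^ (n + 1)) * (r - 1) := by
    rw [← div_lt_iff₀' hprod]; linarith
  linarith

/-- The energy, kinetic minus the defocusing potential, is nonnegative. -/
lemma energy_nonneg (h : IsRadialSolution n p q ω φ w) (hp : 1 < p) (hpq : p < q) {r : ℝ}
    (hr : 0 < r) :
    ω / 2 * φ r ^ 2 + φ r ^ (p + 1) / (p + 1) - φ r ^ (q + 1) / (q + 1) ≤
      (w r / r ^ n) ^ 2 / 2 := by
  set V : ℝ → ℝ := fun s => ω / 2 * s ^ 2 + s ^ (p + 1) / (p + 1) - s ^ (q + 1) / (q + 1) with hV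
  have hVd : ∀ s, 0 < s → HasDerivAt V (nonlin p q ω s) s := fun s hs => by
    have h1 := ((hasDerivAt_pow 2 s).const_mul (ω / 2)).add
      ((Real.hasDerivAt_rpow_const (p := p + 1) (Or.inl hs.ne')).div_const (p + 1))
    have h2 := h1.sub
      ((Real.hasDerivAt_rpow_const (p := q + 1) (Or.inl hs.ne')).div_const (q + 1))
    refine HasDerivAt.congr_deriv h2 ?_
    have : p + 1 ≠ 0 := by linarith
    have : q + 1 ≠ 0 := by linarith
    simp only [nonlin, add_sub_cancel_right]
    field_simp
    simp only [Nat.cast_ofNat]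
    ring
  -- Along the system the energy has derivative -n φ'²/s: the nonlinear terms cancel and only the
  -- friction remains.
  have hEd : ∀ s, 0 < s → HasDerivAt (fun s => (w s / s ^ n) ^ 2 / 2 - V (φ s))
      (-(n * (w s / s ^ n) ^ 2 / s)) s := fun s hs => by
    have h1 := (h.hasDerivAt_flux s hs).div (hasDerivAt_pow n s) (pow_pos hs n).ne'
    have h2 := ((h1.pow 2).div_const 2).sub ((hVd (φ s) (h.pos s hs)).comp s (h.hasDerivAt s hs))
    refine HasDerivAt.congr_deriv h2 ?_
    rcases n with _ | k
    · simp
      ring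
    · simp only [Pi.div_apply, Nat.add_sub_cancel]
      push_cast
      field_simp
      ring
  have hanti : AntitoneOn (fun s => (w s / s ^ n) ^ 2 / 2 - V (φ s)) (Ioi 0) := by
    refine antitoneOn_of_hasDerivWithinAt_nonpos (convex_Ioi 0)
      (fun s hs => (hEd s hs).continuousAt.continuousWithinAt)
      (fun s hs => (hEd s (interior_subset hs)).hasDerivWithinAt) fun s hs => ?_
    have : 0 < s := interior_subset hs
    simp only [Left.neg_nonpos_iff]
    positivity
  -- No limit of φ' is needed: -V(φ(s)) ≤ E(s) ≤ E(r) for s ≥ r, where E is the energy, and the left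
  -- side tends to 0.
  have hlim : Tendsto (fun s => -V (φ s)) atTop (𝓝 0) := by
    have hc : ContinuousAt V 0 := by
      have h1 : ContinuousAt (fun s : ℝ => s ^ (p + 1)) 0 :=
        Real.continuousAt_rpow_const _ _ (Or.inr (by linarith))
      have h2 : ContinuousAt (fun s : ℝ => s ^ (q + 1)) 0 :=
        Real.continuousAt_rpow_const _ _ (Or.inr (by linarith))
      exact ((continuousAt_const.mul (continuousAt_id.pow 2)).add (h1.div_const _)).sub
        (h2.div_const _)
    have hV0 : V 0 = 0 := by
      simp only [hV]
      rw [Real.zero_rpow (by linarith), Real.zero_rpow (by linarith)]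
      simp
    have := (hc.tendsto.comp h.tendsto).neg
    rwa [hV0, neg_zero] at this
  have hge : 0 ≤ (w r / r ^ n) ^ 2 / 2 - V (φ r) := by
    refine le_of_tendsto hlim ?_
    filter_upwards [eventually_ge_atTop r] with s hs
    have h1 := hanti (mem_Ioi.2 hr) (mem_Ioi.2 (hr.trans_le hs)) hs
    have h2 : 0 ≤ (w s / s ^ n) ^ 2 / 2 := by positivity
    simp only at h1
    linarith
  exact sub_nonneg.1 hge

end IsRadialSolution

/-- Decay at the rate `r ^ (-2 / (p - 1))`, uniformly in `ω`. -/
lemma exists_decay_rpow (n : ℕ) {p q : ℝ} (hp : 1 < p) (hpq : p < q) :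
    ∃ C, 0 < C ∧ ∃ R, 0 < R ∧ ∀ ω, 0 ≤ ω → ∀ φ w, IsRadialSolution n p q ω φ w →
      ∀ r, R ≤ r → φ r ≤ C * r ^ (-(2 / (p - 1))) := by
  obtain ⟨c, hc, hc2, hc3⟩ := exists_threshold hp hpq
  have hq1 : 0 < q - 1 := by linarith
  have hp1 : 0 < p - 1 := by linarith
  -- The 2 in place of 1 makes the strict radius condition of `not_dominated` hold at every point of
  -- [R₀, r].
  set R₀ := 2 + 1 / ((q - 1) * (c / 2 ^ (n + 1))) with hR₀
  have hR₀1 : 2 ≤ R₀ := le_add_of_nonneg_right (by positivity)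
  -- The comparison exponent m = (p+1)/2 gives the factor m - 1 = (p-1)/2; the last 1/2 comes from r
  -- - R₀ ≥ r/2 when r ≥ 2R₀.
  set κ := (p - 1) / 2 * √(2 * c) / 2 with hκ
  have hs0 : 0 < √(2 * c) := Real.sqrt_pos.2 (by linarith)
  have hκ0 : 0 < κ := by positivity
  refine ⟨κ ^ (-(2 / (p - 1))), Real.rpow_pos_of_pos hκ0 _, 2 * R₀, by linarith, ?_⟩
  intro ω hω φ w h r hr
  have hrR : R₀ < r := by linarith
  have hr0 : 0 < r := by linarith
  have hcmp := le_rpow_of_deriv_le (y := φ) (h := fun r => r) (h' := fun _ => 1) (a := R₀) (b := r)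
    (m := (p + 1) / 2) (κ := √(2 * c)) hrR (by linarith)
    (fun s hs => h.pos s (by linarith [hs.1]))
    (fun s hs => h.hasDerivAt s (by linarith [hs.1])) (fun s _ => hasDerivAt_id s)
    (fun s hs => by
      have hs0 : 0 < s := by linarith [hs.1]
      have hφs := h.pos s hs0
      rw [mul_one, neg_le_neg_iff]
      have h1 := h.not_dominated hp hpq hω (r := s) hc (by linarith [hs.1])
      have h2 := potential_lower_bound hp hpq hω hφs hc2 hc3 h1.le
      have h3 := h2.trans (h.energy_nonneg hp hpq hs0)
      have hw : 0 ≤ w s / s ^ n := div_nonneg (h.flux_nonneg s hs0) (pow_pos hs0 n).le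
      refine (sq_le_sq₀ (by positivity) hw).1 ?_
      rw [mul_pow, Real.sq_sqrt (by linarith), ← Real.rpow_natCast (φ s ^ ((p + 1) / 2)),
        ← Real.rpow_mul hφs.le]
      have : (p + 1) / 2 * ((2 : ℕ) : ℝ) = p + 1 := by push_cast; ring
      rw [this]
      linarith)
  have hle : κ * r ≤ φ r ^ (1 - (p + 1) / 2) := by
    refine le_trans ?_ hcmp
    have e : ((p + 1) / 2 - 1) * √(2 * c) = 2 * κ := by rw [hκ]; ring
    rw [e]
    nlinarith
  have := le_rpow_neg_of_le_rpow (h.pos r hr0) (mul_pos hκ0 hr0) (by linarith) hle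
  have e : (1 / ((p + 1) / 2 - 1)) = 2 / (p - 1) := by
    rw [show (p + 1) / 2 - 1 = (p - 1) / 2 by ring, one_div_div]
  rwa [e, Real.mul_rpow hκ0.le hr0.le] at this

/-- Beyond a radius independent of `ω`, the defocusing term dominates. -/
lemma exists_half_le_nonlin (n : ℕ) {p q : ℝ} (hp : 1 < p) (hpq : p < q) :
    ∃ R, 1 ≤ R ∧ ∀ ω, 0 ≤ ω → ∀ φ w, IsRadialSolution n p q ω φ w →
      ∀ r, R ≤ r → φ r ≤ 1 ∧ φ r ^ p / 2 ≤ nonlin p q ω (φ r) := by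
  obtain ⟨C, hC, R, hR, hdec⟩ := exists_decay_rpow n hp hpq
  have hp1 : 0 < p - 1 := by linarith
  have hqp : 0 < q - p := by linarith
  -- Heights below ε satisfy φ^(q-p) ≤ 1/2, so φ^q ≤ φ^p/2, and the term ωφ ≥ 0 only helps.
  set ε : ℝ := min 1 ((1 / 2) ^ (1 / (q - p))) with hε
  have hε0 : 0 < ε := lt_min one_pos (Real.rpow_pos_of_pos (by norm_num) _)
  have hlim : Tendsto (fun r : ℝ => C * r ^ (-(2 / (p - 1)))) atTop (𝓝 0) := by
    simpa using (tendsto_rpow_neg_atTop (show 0 < 2 / (p - 1) by positivity)).const_mul C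
  obtain ⟨R', hR'⟩ := eventually_atTop.1 (hlim.eventually_le_const hε0)
  refine ⟨max 1 (max R R'), le_max_left _ _, fun ω hω φ w h r hr => ?_⟩
  have hr1 : 1 ≤ r := (le_max_left _ _).trans hr
  have hφr := h.pos r (by linarith)
  have hle : φ r ≤ ε := (hdec ω hω φ w h r
    ((le_max_left _ _).trans ((le_max_right _ _).trans hr))).trans
    (hR' r ((le_max_right _ _).trans ((le_max_right _ _).trans hr)))
  refine ⟨hle.trans (min_le_left _ _), ?_⟩
  have h1 : φ r ^ (q - p) ≤ 1 / 2 := by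
    calc φ r ^ (q - p) ≤ ((1 / 2 : ℝ) ^ (1 / (q - p))) ^ (q - p) :=
          Real.rpow_le_rpow hφr.le (hle.trans (min_le_right _ _)) hqp.le
      _ = 1 / 2 := by
        rw [← Real.rpow_mul (by norm_num), one_div_mul_cancel hqp.ne', Real.rpow_one]
  have h2 : φ r ^ q = φ r ^ p * φ r ^ (q - p) := by
    rw [← Real.rpow_add hφr]; ring_nf
  have h3 := Real.rpow_pos_of_pos hφr p
  unfold nonlin
  rw [h2]
  nlinarith [mul_nonneg hω hφr.le]

/-! ### Flux bounds, the rate N - 2 and the logarithmic correction -/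

/-- In dimension `k + 2` with `k ≥ 1`, beyond a radius independent of `ω` the flux is bounded, and
it controls `r ^ k φ`. -/
lemma exists_flux_bound {k : ℕ} (hk : 1 ≤ k) {p q : ℝ} (hp : 1 < p) (hpq : p < q) :
    ∃ K, 0 < K ∧ ∃ R, 1 < R ∧ ∀ ω, 0 ≤ ω → ∀ φ w, IsRadialSolution (k + 1) p q ω φ w →
      ∀ r, R ≤ r → φ r ^ p / 2 ≤ nonlin p q ω (φ r) ∧ w r ≤ K ∧ k * (r ^ k * φ r) ≤ w r := by
  obtain ⟨R, hR, hdef⟩ := exists_half_le_nonlin (k + 1) hp hpq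
  refine ⟨(R + 1) ^ (k + 1), by positivity, R + 1, by linarith, fun ω hω φ w h => ?_⟩
  have hwanti : AntitoneOn w (Ici R) := by
    refine antitoneOn_of_hasDerivWithinAt_nonpos (convex_Ici R)
      (fun s (hs : R ≤ s) => (h.hasDerivAt_flux s (by linarith)).continuousAt.continuousWithinAt)
      (fun s hs => (h.hasDerivAt_flux s
        (by linarith [mem_Ici.1 (interior_subset hs)])).hasDerivWithinAt) fun s hs => ?_
    have hs' : R ≤ s := interior_subset hs
    have hs0 : 0 < s := by linarith
    have h1 := (hdef ω hω φ w h s hs').2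
    have h2 := Real.rpow_pos_of_pos (h.pos s hs0) p
    have : 0 ≤ nonlin p q ω (φ s) := by linarith
    simp only [Left.neg_nonpos_iff]
    positivity
  -- As 0 < φ ≤ 1 at the ends of [R, R+1], the mean value theorem finds a point s with w(s) ≤
  -- s^(k+1); monotonicity of w carries the bound to R + 1.
  have hwR : w (R + 1) ≤ (R + 1) ^ (k + 1) := by
    obtain ⟨s, hs, hsd⟩ := exists_hasDerivAt_eq_slope φ (fun s => -(w s / s ^ (k + 1)))
      (lt_add_one R)
      (fun s hs => (h.hasDerivAt s (by linarith [hs.1])).continuousAt.continuousWithinAt)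
      (fun s hs => h.hasDerivAt s (by linarith [hs.1]))
    have hs0 : 0 < s := by linarith [hs.1]
    have hsp : 0 < s ^ (k + 1) := pow_pos hs0 _
    have h1 : w s / s ^ (k + 1) ≤ 1 := by
      have h2 := (hdef ω hω φ w h R le_rfl).1
      have h3 := h.pos (R + 1) (by linarith)
      rw [add_sub_cancel_left, div_one] at hsd
      linarith
    rw [div_le_one hsp] at h1
    calc w (R + 1) ≤ w s := hwanti hs.1.le (by simp) hs.2.le
      _ ≤ _ := h1
      _ ≤ _ := pow_le_pow_left₀ hs0.le hs.2.le _
  intro r hr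
  have hr0 : 0 < r := by linarith
  refine ⟨(hdef ω hω φ w h r (by linarith)).2,
    (hwanti (by simp) (mem_Ici.2 (by linarith)) hr).trans hwR, ?_⟩
  -- For s ≥ r, -φ'(s) = w(s)/s^(k+1) ≤ w(r)/s^(k+1). So φ minus (w(r)/k) s^(-k) increases to its
  -- limit 0 and is nonpositive at r.
  have hk0 : (0 : ℝ) < k := by exact_mod_cast hk
  have hBd : ∀ s, 0 < s → HasDerivAt (fun s => φ s - w r / k * (s ^ k)⁻¹)
      ((w r - w s) / s ^ (k + 1)) s := fun s hs => by
    have h1 := (h.hasDerivAt s hs).sub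
      (((hasDerivAt_pow k s).inv (pow_pos hs k).ne').const_mul (w r / k))
    refine HasDerivAt.congr_deriv h1 ?_
    obtain ⟨j, rfl⟩ : ∃ j, k = j + 1 := ⟨k - 1, by omega⟩
    simp only [Nat.add_sub_cancel]
    field_simp
    ring
  have hmono : MonotoneOn (fun s => φ s - w r / k * (s ^ k)⁻¹) (Ici r) := by
    refine monotoneOn_of_hasDerivWithinAt_nonneg (convex_Ici r)
      (fun s (hs : r ≤ s) => (hBd s (by linarith)).continuousAt.continuousWithinAt)
      (fun s hs => (hBd s (by linarith [mem_Ici.1 (interior_subset hs)])).hasDerivWithinAt)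
      fun s hs => ?_
    have hs' : r ≤ s := interior_subset hs
    have hs0 : 0 < s := by linarith
    refine div_nonneg (sub_nonneg.2 (hwanti ?_ ?_ hs')) (pow_pos hs0 _).le
    · exact mem_Ici.2 (by linarith)
    · exact mem_Ici.2 (by linarith)
  have hlim : Tendsto (fun s => φ s - w r / k * (s ^ k)⁻¹) atTop (𝓝 0) := by
    have h1 : Tendsto (fun s : ℝ => (s ^ k)⁻¹) atTop (𝓝 0) :=
      (tendsto_pow_atTop (by omega)).inv_tendsto_atTop
    simpa using h.tendsto.sub (h1.const_mul (w r / k))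
  have hle : φ r - w r / k * (r ^ k)⁻¹ ≤ 0 := by
    refine ge_of_tendsto hlim ?_
    filter_upwards [eventually_ge_atTop r] with s hs
    exact hmono (mem_Ici.2 le_rfl) (mem_Ici.2 hs) hs
  have hrk := pow_pos hr0 k
  have : φ r ≤ w r / k / r ^ k := by rw [div_eq_mul_inv _ (r ^ k)]; linarith
  rw [le_div_iff₀ hrk, le_div_iff₀ hk0] at this
  linarith

/-- Logarithmic improvement at the critical exponent `p = (k + 2) / k`. -/
lemma exists_decay_log {k : ℕ} (hk : 1 ≤ k) {p q : ℝ} (hpk : p = ((k : ℝ) + 2) / k)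
    (hpq : p < q) :
    ∃ C, 0 < C ∧ ∃ R, 1 < R ∧ ∀ ω, 0 ≤ ω → ∀ φ w, IsRadialSolution (k + 1) p q ω φ w →
      ∀ r, R ≤ r → φ r ≤ C * r ^ (-(k : ℝ)) * Real.log r ^ (-((k : ℝ) / 2)) := by
  have hk0 : (0 : ℝ) < k := by exact_mod_cast hk
  have hk1 : (1 : ℝ) ≤ k := by exact_mod_cast hk
  have hp1 : p - 1 = 2 / k := by rw [hpk]; field_simp; ring
  have hp1' : 0 < p - 1 := by rw [hp1]; positivity
  have hp : 1 < p := by linarith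
  obtain ⟨K, hK, R, hR, hflux⟩ := exists_flux_bound hk hp hpq
  -- The two entries serve the cases w ≤ 2ku and w ≥ 2ku below; 2^p pays for w + u ≤ 2w.
  set κ : ℝ := min (1 / (2 * (2 * (k : ℝ)) ^ p)) (1 / (2 * K ^ (p - 1))) / 2 ^ p with hκ
  have hκ0 : 0 < κ := by
    have := Real.rpow_pos_of_pos hK (p - 1)
    have := Real.rpow_pos_of_pos (show (0 : ℝ) < 2 * k by positivity) p
    have := Real.rpow_pos_of_pos (show (0 : ℝ) < 2 by norm_num) p
    exact div_pos (lt_min (by positivity) (by positivity)) this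
  have hA0 : 0 < (p - 1) * κ / 2 := by positivity
  refine ⟨((p - 1) * κ / 2) ^ (-((k : ℝ) / 2)), Real.rpow_pos_of_pos hA0 _, R ^ 2 + 1,
    by nlinarith, fun ω hω φ w h r hr => ?_⟩
  have hrR : R < r := by nlinarith
  have hr0 : 0 < r := by linarith
  set u : ℝ → ℝ := fun s => s ^ k * φ s with hu
  have hud : ∀ s, 0 < s → HasDerivAt u ((k * u s - w s) / s) s := fun s hs => by
    have h1 := (hasDerivAt_pow k s).mul (h.hasDerivAt s hs)
    refine HasDerivAt.congr_deriv h1 ?_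
    obtain ⟨j, rfl⟩ : ∃ j, k = j + 1 := ⟨k - 1, by omega⟩
    simp only [Nat.add_sub_cancel, hu]
    field_simp
    ring
  -- The flux alone does not suffice: w' is controlled by u, and u ≤ w/k gives no lower bound for u.
  -- Adding u contributes the dissipation w - ku, which takes over when u is small compared with w.
  have hcmp := le_rpow_of_deriv_le (y := fun s => w s + u s) (h := Real.log) (h' := fun s => s⁻¹)
    (a := R) (b := r) (m := p) (κ := κ) hrR hp
    (fun s hs => by
      have hs0 : 0 < s := by linarith [hs.1]
      exact add_pos_of_nonneg_of_pos (h.flux_nonneg s hs0) (mul_pos (pow_pos hs0 k) (h.pos s hs0)))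
    (fun s hs => (h.hasDerivAt_flux s (by linarith [hs.1])).add (hud s (by linarith [hs.1])))
    (fun s hs => Real.hasDerivAt_log (by linarith [hs.1]))
    (fun s hs => by
      have hs0 : 0 < s := by linarith [hs.1]
      obtain ⟨hnl, hwK, hku⟩ := hflux ω hω φ w h s hs.1
      have hu0 : 0 < u s := mul_pos (pow_pos hs0 k) (h.pos s hs0)
      change k * u s ≤ w s at hku
      have hw0 : 0 < w s := by nlinarith
      have huw : u s ≤ w s := by nlinarith
      -- Criticality enters here: kp = k + 2 makes u^p = s^(k+2) φ^p.
      have e : s ^ (k + 1) * φ s ^ p = u s ^ p / s := by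
        simp only [hu]
        rw [Real.mul_rpow (pow_pos hs0 k).le (h.pos s hs0).le, ← Real.rpow_natCast s k,
          ← Real.rpow_mul hs0.le, show (k : ℝ) * p = ((k + 2 : ℕ) : ℝ) by
            rw [hpk]; push_cast; field_simp, Real.rpow_natCast]
        field_simp
        ring
      have hkey : κ * (w s + u s) ^ p ≤ u s ^ p / 2 + (w s - k * u s) := by
        have hz : (w s + u s) ^ p ≤ 2 ^ p * w s ^ p := by
          rw [← Real.mul_rpow (by norm_num) hw0.le]
          exact Real.rpow_le_rpow (by linarith) (by linarith) (by linarith)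
        have h2p := Real.rpow_pos_of_pos (show (0 : ℝ) < 2 by norm_num) p
        have hwp := Real.rpow_pos_of_pos hw0 p
        have hup := Real.rpow_pos_of_pos hu0 p
        have h1 : κ * (w s + u s) ^ p ≤
            min (1 / (2 * (2 * (k : ℝ)) ^ p)) (1 / (2 * K ^ (p - 1))) * w s ^ p := by
          calc κ * (w s + u s) ^ p ≤ κ * (2 ^ p * w s ^ p) := by gcongr
            _ = _ := by rw [hκ]; field_simp
        refine h1.trans ?_
        rcases le_total (w s) (2 * k * u s) with hc | hc
        · have h2k := Real.rpow_pos_of_pos (show (0 : ℝ) < 2 * k by positivity) p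
          have h2 : w s ^ p ≤ (2 * (k : ℝ)) ^ p * u s ^ p := by
            rw [← Real.mul_rpow (by positivity) hu0.le]
            exact Real.rpow_le_rpow hw0.le hc (by linarith)
          calc _ ≤ 1 / (2 * (2 * (k : ℝ)) ^ p) * w s ^ p := by
                gcongr; exact min_le_left _ _
            _ ≤ 1 / (2 * (2 * (k : ℝ)) ^ p) * ((2 * (k : ℝ)) ^ p * u s ^ p) := by gcongr
            _ = u s ^ p / 2 := by field_simp
            _ ≤ _ := by linarith
        · have hKp := Real.rpow_pos_of_pos hK (p - 1)
          have h2 : w s ^ p ≤ K ^ (p - 1) * w s := by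
            calc w s ^ p = w s ^ (p - 1) * w s := by
                  rw [← Real.rpow_add_one hw0.ne', sub_add_cancel]
              _ ≤ _ := by
                have := Real.rpow_le_rpow hw0.le hwK hp1'.le
                gcongr
          calc _ ≤ 1 / (2 * K ^ (p - 1)) * w s ^ p := by
                gcongr; exact min_le_right _ _
            _ ≤ 1 / (2 * K ^ (p - 1)) * (K ^ (p - 1) * w s) := by gcongr
            _ = w s / 2 := by field_simp
            _ ≤ _ := by linarith
      have hnl' : s ^ (k + 1) * (φ s ^ p / 2) ≤ s ^ (k + 1) * nonlin p q ω (φ s) := by gcongr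
      have e2 : s ^ (k + 1) * (φ s ^ p / 2) = u s ^ p / 2 / s := by
        rw [← mul_div_assoc, e]; ring
      have h3 : κ * (w s + u s) ^ p * s⁻¹ ≤ (u s ^ p / 2 + (w s - k * u s)) * s⁻¹ := by gcongr
      have e3 : (u s ^ p / 2 + (w s - k * u s)) * s⁻¹ = u s ^ p / 2 / s - (k * u s - w s) / s := by
        ring
      rw [e3] at h3
      linarith)
  have hlogR : 0 < Real.log R := Real.log_pos hR
  -- The starting radius R² + 1 ensures log r - log R ≥ (log r)/2.
  have hlogr : 2 * Real.log R ≤ Real.log r := by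
    have h1 : Real.log (R ^ 2) ≤ Real.log r := Real.log_le_log (by positivity) (by linarith)
    rwa [Real.log_pow] at h1
  have hlog0 : 0 < Real.log r := by linarith
  have hz0 : 0 < w r + u r := add_pos_of_nonneg_of_pos (h.flux_nonneg r hr0)
    (mul_pos (pow_pos hr0 k) (h.pos r hr0))
  have hle : (p - 1) * κ / 2 * Real.log r ≤ (w r + u r) ^ (1 - p) := by
    refine le_trans ?_ hcmp
    have : 0 < (p - 1) * κ := by positivity
    nlinarith
  have hfin := le_rpow_neg_of_le_rpow hz0 (mul_pos hA0 hlog0) hp hle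
  rw [hp1, one_div_div, ← hp1, Real.mul_rpow hA0.le hlog0.le] at hfin
  have hur : r ^ k * φ r ≤ w r + u r := le_add_of_nonneg_left (h.flux_nonneg r hr0)
  have hrk := pow_pos hr0 k
  have h4 : φ r ≤ (r ^ k)⁻¹ * (((p - 1) * κ / 2) ^ (-((k : ℝ) / 2)) *
      Real.log r ^ (-((k : ℝ) / 2))) := by
    rw [← div_eq_inv_mul, le_div_iff₀ hrk]
    linarith
  rw [Real.rpow_neg hr0.le, Real.rpow_natCast]
  linarith

end DoublePower

/-! ### The decay estimates for ground states -/

theorem proposition3p5 (N : ℕ) (hN : 1 ≤ N) (p q : ℝ) (hp : 1 < p) (hpq : p < q)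
    (hq : 3 ≤ N → q < 1 + 4 / ((N : ℝ) - 2)) :
    (∃ C : ℝ, 0 < C ∧ ∃ R : ℝ, 0 < R ∧
      ∀ ω ∈ Set.Icc (0 : ℝ) 1, ∀ φ : ℝ → ℝ, DoublePower.IsGroundStateProfile N p q ω φ →
        ∀ r : ℝ, R ≤ r → φ r ≤ C * r ^ (-(max (2 / (p - 1)) ((N : ℝ) - 2)))) ∧
    (3 ≤ N → p = (N : ℝ) / ((N : ℝ) - 2) →
      ∃ C : ℝ, 0 < C ∧ ∃ R : ℝ, 1 < R ∧
        ∀ ω ∈ Set.Icc (0 : ℝ) 1, ∀ φ : ℝ → ℝ, DoublePower.IsGroundStateProfile N p q ω φ →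
          ∀ r : ℝ, R ≤ r →
            φ r ≤ C * r ^ (-((N : ℝ) - 2)) * Real.log r ^ (-(((N : ℝ) - 2) / 2))) := by
  have hq1 : 1 < q := hp.trans hpq
  have hp1 : 0 < p - 1 := by linarith
  refine ⟨?_, ?_⟩
  · rcases le_or_gt ((N : ℝ) - 2) (2 / (p - 1)) with hle | hlt
    · obtain ⟨n, rfl⟩ : ∃ n, N = n + 1 := ⟨N - 1, by omega⟩
      rw [max_eq_left hle]
      obtain ⟨C, hC, R, hR, H⟩ := DoublePower.exists_decay_rpow n hp hpq
      refine ⟨C, hC, R, hR, fun ω hω φ hφ r hr => ?_⟩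
      obtain ⟨w, hw⟩ := hφ.exists_isRadialSolution hp hq1 hω.1
      exact H ω hω.1 φ w hw r hr
    -- If N - 2 is the larger exponent, it exceeds 2/(p-1) > 0, which forces N ≥ 3 and makes the
    -- flux bound available.
    · have hN2 : (2 : ℝ) < N := by
        have : 0 < 2 / (p - 1) := by positivity
        linarith
      have hN3 : 2 < N := by exact_mod_cast hN2
      obtain ⟨k, rfl⟩ : ∃ k, N = k + 1 + 1 := ⟨N - 2, by omega⟩
      have hk : 1 ≤ k := by omega
      have hk1 : (1 : ℝ) ≤ k := by exact_mod_cast hk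
      rw [max_eq_right hlt.le]
      obtain ⟨K, hK, R, hR, H⟩ := DoublePower.exists_flux_bound hk hp hpq
      refine ⟨K, hK, R, by linarith, fun ω hω φ hφ r hr => ?_⟩
      obtain ⟨w, hw⟩ := hφ.exists_isRadialSolution hp hq1 hω.1
      obtain ⟨-, hwK, hkφ⟩ := H ω hω.1 φ w hw r hr
      have hr0 : 0 < r := by linarith
      have hrk := pow_pos hr0 k
      have e : (((k + 1 + 1 : ℕ) : ℝ) - 2) = k := by push_cast; ring
      rw [e, Real.rpow_neg hr0.le, Real.rpow_natCast, ← div_eq_mul_inv, le_div_iff₀ hrk]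
      have := mul_pos hrk (hw.pos r hr0)
      nlinarith
  · intro hN3 hpN
    obtain ⟨k, rfl⟩ : ∃ k, N = k + 1 + 1 := ⟨N - 2, by omega⟩
    have e : (((k + 1 + 1 : ℕ) : ℝ) - 2) = k := by push_cast; ring
    rw [e] at hpN ⊢
    obtain ⟨C, hC, R, hR, H⟩ := DoublePower.exists_decay_log (k := k) (by omega)
      (by rw [hpN]; push_cast; ring) hpq
    refine ⟨C, hC, R, hR, fun ω hω φ hφ r hr => ?_⟩
    obtain ⟨w, hw⟩ := hφ.exists_isRadialSolution hp hq1 hω.1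
    exact H ω hω.1 φ w hw r hr
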